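/- Let $\kappa\in\mathbb R$, $\kappa\neq 0$, put $\kappa'=\kappa/4$, and let $\mathbb E^3(\kappa,0)$ be $\Omega_\kappa\times\mathbb R$ with coordinates $(w=x_1+ix_2,\,x_3)$ and metric $\lambda^2|dw|^2+dx_3^2$, $\lambda=(1+\kappa'|w|^2)^{-1}$, where $\Omega_\kappa=\mathbb C$ if $\kappa>0$ and $\Omega_\kappa=\{|w|<2|\kappa|^{-1/2}\}$ if $\kappa<0$. Consider the isometries $$\mathcal S_1(t)(w,x_3)=\Big(\tfrac{t+w}{1-\kappa' tw},x_3\Big),\qquad \mathcal S_2(t)(w,x_3)=\Big(\tfrac{it+w}{1+i\kappa' tw},x_3\Big),\qquad \mathcal S_R(t)(w,x_3)=(e^{it}w,x_3),$$ (for $\mathcal S_1,\mathcal S_2$: wherever defined, with $1+\kappa' t^2>0$), with infinitesimal generators $$S_1=(1+\kappa'(x_1^2-x_2^2))\partial_1+2\kappa'x_1x_2\partial_2,\quad S_2=2\kappa'x_1x_2\partial_1+(1-\kappa'(x_1^2-x_2^2))\partial_2,\quad S_R=-x_2\partial_1+x_1\partial_2 .$$ Let $f:\Sigma\to\mathbb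 E^3(\kappa,0)$ be a smooth immersion of a surface, oriented by a smooth unit normal $N$, of constant mean curvature $H$ with respect to $N$ (half the trace of $\langle\nabla df,N\rangle$; minimal if $H=0$). For $j\in\{1,2,R\}$ let $F_j$ be any smooth vector field on $\mathbb E^3(\kappa,0)$ with $\operatorname{rot}F_j=S_j$, let $$\mu_j=\mathrm{vol}(N,S_j,df(\cdot))-2H\langle F_j,df(\cdot)\rangle$$ be the corresponding Noether form on $\Sigma$, and let $\sigma_j(c)=\int_c\mu_j$ for a cycle $c$. We say that $f$ is invariant under an isometry $\Phi$ via a diffeomorphism $\varphi$ of $\Sigma$ if $\Phi$ is defined on $f(\Sigma)$, $\Phi\circ f=f\circ\varphi$ and $d\Phi(N)=N\circ\varphi$; the image $\Phi\cdot c$ of a cycle $c$ is then $\varphi_*c$. (i) If $f$ is invariant under the family of translations $\mathcal S_1$ (resp. $\mathcal S_2$), that is, under $\mathcal S_1(t)$ (resp. $\mathcal S_2(t)$) via some $\varphi_t$ for every $t$ with $1+\kappa't^2>0$, then $\mu_2=\mu_R=0$ (resp. $\mu_1=\mu_R=0$) in $H^1(\Sigma)$: these forms are exact, and their integrals over all cycles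 vanish. Moreover, if $f$ is invariant under a single $\mathcal S_1(t)$ (resp. $\mathcal S_2(t)$), $t\neq0$, $1+\kappa't^2>0$, via $\varphi$, and $c$ is a cycle homologous to $\varphi_*c$, then $\sigma_2(c)=\sigma_R(c)=0$ (resp. $\sigma_1(c)=\sigma_R(c)=0$). (ii) If $f$ is invariant under a rotation $\mathcal S_R(t)$, $t\notin2\pi\mathbb Z$, via $\varphi$, and $c$ is a cycle homologous to $\varphi_*c$, then $\sigma_1(c)=\sigma_2(c)=0$. -/

import Mathlib

open Set
open scoped Manifold ContDiff

noncomputable section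

namespace NoetherE3

/-! ### The ambient space `E³(κ, 0)`: the domain `Ω_κ × ℝ` in `ℂ × ℝ`, points being `(w, x₃)`,
`w = x₁ + i x₂`. Tangent vectors are elements of `ℂ × ℝ`. -/

/-- The model domain: `Ω_κ = ℂ` if `κ ≥ 0` and the disk of radius `2 |κ|^{-1/2}` if `κ < 0`. -/
def space (κ : ℝ) : Set (ℂ × ℝ) :=
  {p | κ < 0 → ‖p.1‖ < 2 / Real.sqrt |κ|}

/-- The conformal factor `λ = 1 / (1 + (κ/4) |w|²)`. -/
def conf (κ : ℝ) (p : ℂ × ℝ) : ℝ := 1 / (1 + κ / 4 * ‖p.1‖ ^ 2)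

/-- The metric `λ² |dw|² + dx₃²`. -/
def metric (κ : ℝ) (p u v : ℂ × ℝ) : ℝ :=
  conf κ p ^ 2 * (u.1.re * v.1.re + u.1.im * v.1.im) + u.2 * v.2

/-- The riemannian volume form `λ² dx₁ ∧ dx₂ ∧ dx₃`. -/
def vol (κ : ℝ) (p u v w : ℂ × ℝ) : ℝ :=
  conf κ p ^ 2 *
    Matrix.det !![u.1.re, u.1.im, u.2; v.1.re, v.1.im, v.2; w.1.re, w.1.im, w.2]

/-- The Levi-Civita connection on constant vector fields, `⟨∇_u v, w⟩` at `p`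
(Koszul formula, i.e. Christoffel symbols of the first kind). -/
def christoffel (κ : ℝ) (p u v w : ℂ × ℝ) : ℝ :=
  (fderiv ℝ (fun q => metric κ q v w) p u + fderiv ℝ (fun q => metric κ q u w) p v
    - fderiv ℝ (fun q => metric κ q u v) p w) / 2

/-- `F` is a potential vector of `S`: `F` is a smooth field on `E³(κ, 0)` with `rot F = S`, where
`rot F` is characterised by `rot F ⌟ vol = d F^♭`. -/
def IsPotential (κ : ℝ) (S F : ℂ × ℝ → ℂ × ℝ) : Prop :=
  ContDiffOn ℝ ∞ F (space κ) ∧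
    ∀ p ∈ space κ, ∀ u v : ℂ × ℝ,
      fderiv ℝ (fun q => metric κ q (F q) v) p u - fderiv ℝ (fun q => metric κ q (F q) u) p v
        = vol κ p (S p) u v

/-! ### Isometries and their infinitesimal generators -/

/-- The translation `𝒮₁(t)`. -/
def trans1 (κ t : ℝ) (p : ℂ × ℝ) : ℂ × ℝ :=
  ((t + p.1) / (1 - (κ / 4 : ℝ) * t * p.1), p.2)

/-- Where `trans1 κ t` is defined (its pole is removed; it matters only for `κ > 0`). -/
def dom1 (κ t : ℝ) : Set (ℂ × ℝ) := {p | 1 - (κ / 4 : ℝ) * t * p.1 ≠ 0}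

/-- The translation `𝒮₂(t)`. -/
def trans2 (κ t : ℝ) (p : ℂ × ℝ) : ℂ × ℝ :=
  ((Complex.I * t + p.1) / (1 + Complex.I * (κ / 4 : ℝ) * t * p.1), p.2)

/-- Where `trans2 κ t` is defined. -/
def dom2 (κ t : ℝ) : Set (ℂ × ℝ) := {p | 1 + Complex.I * (κ / 4 : ℝ) * t * p.1 ≠ 0}

/-- The rotation `𝒮_R(t)`. -/
def rot (t : ℝ) (p : ℂ × ℝ) : ℂ × ℝ := (p.1 * Complex.exp (Complex.I * t), p.2)

/-- The parameters `t` of the translations `𝒮₁(t)`, `𝒮₂(t)`: all of `ℝ` if `κ ≥ 0`,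
and `|t| < 2 |κ|^{-1/2}` if `κ < 0`. -/
def IsParam (κ t : ℝ) : Prop := 0 < 1 + κ / 4 * t ^ 2

/-- The infinitesimal generator `S₁` of the family `𝒮₁(t)`. -/
def gen1 (κ : ℝ) (p : ℂ × ℝ) : ℂ × ℝ :=
  (⟨1 + κ / 4 * (p.1.re ^ 2 - p.1.im ^ 2), 2 * (κ / 4) * p.1.re * p.1.im⟩, 0)

/-- The infinitesimal generator `S₂` of the family `𝒮₂(t)`. -/
def gen2 (κ : ℝ) (p : ℂ × ℝ) : ℂ × ℝ :=
  (⟨2 * (κ / 4) * p.1.re * p.1.im, 1 - κ / 4 * (p.1.re ^ 2 - p.1.im ^ 2)⟩, 0)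

/-- The infinitesimal generator `S_R` of the family `𝒮_R(t)`. -/
def genR (p : ℂ × ℝ) : ℂ × ℝ := (⟨-p.1.im, p.1.re⟩, 0)

/-! ### Surfaces -/

/-- `f` is an immersion into `E³(κ, 0)`, oriented by the smooth unit normal field `N`. -/
structure IsOrientedImmersion (κ : ℝ) {X : Type*} [TopologicalSpace X]
    [ChartedSpace (EuclideanSpace ℝ (Fin 2)) X] (f N : X → ℂ × ℝ) : Prop where
  mem_space : ∀ p, f p ∈ space κ
  smooth : ContMDiff (𝓡 2) 𝓘(ℝ, ℂ × ℝ) ∞ f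
  injective : ∀ p, Function.Injective (mfderiv (𝓡 2) 𝓘(ℝ, ℂ × ℝ) f p)
  smooth_normal : ContMDiff (𝓡 2) 𝓘(ℝ, ℂ × ℝ) ∞ N
  unit : ∀ p, metric κ (f p) (N p) (N p) = 1
  normal : ∀ p, ∀ v : TangentSpace (𝓡 2) p,
    metric κ (f p) (N p) (mfderiv (𝓡 2) 𝓘(ℝ, ℂ × ℝ) f p v) = 0

/-- The immersion read in the chart of `X` at `p`. -/
def inChart {X : Type*} [TopologicalSpace X] [ChartedSpace (EuclideanSpace ℝ (Fin 2)) X]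
    (f : X → ℂ × ℝ) (p : X) (y : EuclideanSpace ℝ (Fin 2)) : ℂ × ℝ :=
  f ((extChartAt (𝓡 2) p).symm y)

/-- The partial derivative `∂ᵢ f` in the chart at `p`. -/
def partialD {X : Type*} [TopologicalSpace X] [ChartedSpace (EuclideanSpace ℝ (Fin 2)) X]
    (f : X → ℂ × ℝ) (p : X) (i : Fin 2) (y : EuclideanSpace ℝ (Fin 2)) : ℂ × ℝ :=
  fderiv ℝ (inChart f p) y (EuclideanSpace.single i 1)

/-- The coefficient `gᵢⱼ` at `p` of the first fundamental form. -/
def firstForm (κ : ℝ) {X : Type*} [TopologicalSpace X]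
    [ChartedSpace (EuclideanSpace ℝ (Fin 2)) X] (f : X → ℂ × ℝ) (p : X) (i j : Fin 2) : ℝ :=
  metric κ (f p) (partialD f p i (extChartAt (𝓡 2) p p)) (partialD f p j (extChartAt (𝓡 2) p p))

/-- The coefficient `hᵢⱼ = ⟨∇_{∂ᵢ f} ∂ⱼ f, N⟩` at `p` of the second fundamental form. -/
def secondForm (κ : ℝ) {X : Type*} [TopologicalSpace X]
    [ChartedSpace (EuclideanSpace ℝ (Fin 2)) X] (f N : X → ℂ × ℝ) (p : X) (i j : Fin 2) : ℝ :=
  metric κ (f p)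
      (fderiv ℝ (partialD f p j) (extChartAt (𝓡 2) p p) (EuclideanSpace.single i 1)) (N p)
    + christoffel κ (f p) (partialD f p i (extChartAt (𝓡 2) p p))
        (partialD f p j (extChartAt (𝓡 2) p p)) (N p)

/-- The mean curvature with respect to `N`: half the trace of the second fundamental form with
respect to the first one. -/
def meanCurvature (κ : ℝ) {X : Type*} [TopologicalSpace X]
    [ChartedSpace (EuclideanSpace ℝ (Fin 2)) X] (f N : X → ℂ × ℝ) (p : X) : ℝ :=
  (secondForm κ f N p 0 0 * firstForm κ f p 1 1
      - 2 * secondForm κ f N p 0 1 * firstForm κ f p 0 1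
      + secondForm κ f N p 1 1 * firstForm κ f p 0 0)
    / (2 * (firstForm κ f p 0 0 * firstForm κ f p 1 1 - firstForm κ f p 0 1 ^ 2))

/-- An oriented immersion of constant mean curvature `H` (minimal if `H = 0`). -/
def IsCMC (κ H : ℝ) {X : Type*} [TopologicalSpace X]
    [ChartedSpace (EuclideanSpace ℝ (Fin 2)) X] (f N : X → ℂ × ℝ) : Prop :=
  IsOrientedImmersion κ f N ∧ ∀ p, meanCurvature κ f N p = H

/-- The pull-back to the surface of the Noether form `μ_S = S ⌟ Λ₀ - 2 H F^♭`, where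
`Λ₀ = e₀ ⌟ vol` and `e₀` is pulled back to the unit normal `N`. -/
def noetherForm (κ H : ℝ) {X : Type*} [TopologicalSpace X]
    [ChartedSpace (EuclideanSpace ℝ (Fin 2)) X] (f N : X → ℂ × ℝ) (S F : ℂ × ℝ → ℂ × ℝ)
    (p : X) (v : TangentSpace (𝓡 2) p) : ℝ :=
  vol κ (f p) (N p) (S (f p)) (mfderiv (𝓡 2) 𝓘(ℝ, ℂ × ℝ) f p v)
    - 2 * H * metric κ (f p) (F (f p)) (mfderiv (𝓡 2) 𝓘(ℝ, ℂ × ℝ) f p v)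

/-- The oriented immersion `(f, N)` is invariant under the isometry `Φ`, defined on `D`, through
the diffeomorphism `φ` of the surface: `Φ ∘ f = f ∘ φ`, and `dΦ` maps normal to normal. -/
structure IsInvariantVia {X : Type*} [TopologicalSpace X]
    [ChartedSpace (EuclideanSpace ℝ (Fin 2)) X] (f N : X → ℂ × ℝ) (D : Set (ℂ × ℝ))
    (Φ : ℂ × ℝ → ℂ × ℝ) (φ : X ≃ₘ^∞⟮𝓡 2, 𝓡 2⟯ X) : Prop where
  mem_dom : ∀ p, f p ∈ D
  map_eq : ∀ p, Φ (f p) = f (φ p)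
  normal_eq : ∀ p, fderiv ℝ Φ (f p) (N p) = N (φ p)

/-- `IsInvariantVia` for some diffeomorphism of the surface. -/
def IsInvariantUnder {X : Type*} [TopologicalSpace X]
    [ChartedSpace (EuclideanSpace ℝ (Fin 2)) X] (f N : X → ℂ × ℝ) (D : Set (ℂ × ℝ))
    (Φ : ℂ × ℝ → ℂ × ℝ) : Prop :=
  ∃ φ : X ≃ₘ^∞⟮𝓡 2, 𝓡 2⟯ X, IsInvariantVia f N D Φ φ

/-! ### Smooth singular chains, homology and integration -/

/-- The standard `2`-simplex, with vertices `(0,0)`, `(1,0)`, `(0,1)`. -/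
def triangle : Set (ℝ × ℝ) := {q | 0 ≤ q.1 ∧ 0 ≤ q.2 ∧ q.1 + q.2 ≤ 1}

/-- Smooth singular `1`-simplices. -/
def Simplex1 (X : Type*) [TopologicalSpace X] [ChartedSpace (EuclideanSpace ℝ (Fin 2)) X] :
    Type _ :=
  {γ : Icc (0 : ℝ) 1 → X // ∃ g : ℝ → X,
    (∀ t ∈ Icc (0 : ℝ) 1, ContMDiffAt 𝓘(ℝ, ℝ) (𝓡 2) ∞ g t) ∧ ∀ t, γ t = g t}

/-- Smooth singular `2`-simplices. -/
def Simplex2 (X : Type*) [TopologicalSpace X] [ChartedSpace (EuclideanSpace ℝ (Fin 2)) X] :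
    Type _ :=
  {s : triangle → X // ∃ g : ℝ × ℝ → X,
    (∀ q ∈ triangle, ContMDiffAt 𝓘(ℝ, ℝ × ℝ) (𝓡 2) ∞ g q) ∧ ∀ q, s q = g q}

/-- The singular `1`-simplex `t ↦ s (a t)`, for a smooth `a` mapping `[0, 1]` to the triangle. -/
def Simplex2.comp {X : Type*} [TopologicalSpace X] [ChartedSpace (EuclideanSpace ℝ (Fin 2)) X]
    (s : Simplex2 X) (a : ℝ → ℝ × ℝ) (ha : ContDiff ℝ ∞ a)
    (hm : ∀ t ∈ Icc (0 : ℝ) 1, a t ∈ triangle) : Simplex1 X :=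
  ⟨fun t => s.1 ⟨a t, hm t t.2⟩, by
    obtain ⟨g, hg, h⟩ := s.2
    exact ⟨g ∘ a, fun t ht => (hg (a t) (hm t ht)).comp t ha.contMDiff.contMDiffAt,
      fun t => h _⟩⟩

/-- The face opposite to the vertex `(0,0)`. -/
def Simplex2.face0 {X : Type*} [TopologicalSpace X]
    [ChartedSpace (EuclideanSpace ℝ (Fin 2)) X] (s : Simplex2 X) : Simplex1 X :=
  s.comp (fun t => (1 - t, t)) (by fun_prop)
    (fun t ht => ⟨by simpa using ht.2, ht.1, by simp⟩)

/-- The face opposite to the vertex `(1,0)`. -/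
def Simplex2.face1 {X : Type*} [TopologicalSpace X]
    [ChartedSpace (EuclideanSpace ℝ (Fin 2)) X] (s : Simplex2 X) : Simplex1 X :=
  s.comp (fun t => (0, t)) (by fun_prop)
    (fun t ht => ⟨le_refl _, ht.1, by simpa using ht.2⟩)

/-- The face opposite to the vertex `(0,1)`. -/
def Simplex2.face2 {X : Type*} [TopologicalSpace X]
    [ChartedSpace (EuclideanSpace ℝ (Fin 2)) X] (s : Simplex2 X) : Simplex1 X :=
  s.comp (fun t => (t, 0)) (by fun_prop)
    (fun t ht => ⟨ht.1, le_refl _, by simpa using ht.2⟩)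

/-- The boundary of a `1`-chain. -/
def boundary1 {X : Type*} [TopologicalSpace X] [ChartedSpace (EuclideanSpace ℝ (Fin 2)) X]
    (c : Simplex1 X →₀ ℤ) : X →₀ ℤ :=
  c.sum fun γ n => Finsupp.single (γ.1 1) n - Finsupp.single (γ.1 0) n

/-- The boundary of a `2`-chain. -/
def boundary2 {X : Type*} [TopologicalSpace X] [ChartedSpace (EuclideanSpace ℝ (Fin 2)) X]
    (b : Simplex2 X →₀ ℤ) : Simplex1 X →₀ ℤ :=
  b.sum fun s n =>
    Finsupp.single s.face0 n - Finsupp.single s.face1 n + Finsupp.single s.face2 n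

/-- `c` is a `1`-cycle. -/
def IsCycle {X : Type*} [TopologicalSpace X] [ChartedSpace (EuclideanSpace ℝ (Fin 2)) X]
    (c : Simplex1 X →₀ ℤ) : Prop :=
  boundary1 c = 0

/-- `c` and `c'` are homologous. -/
def Homologous {X : Type*} [TopologicalSpace X] [ChartedSpace (EuclideanSpace ℝ (Fin 2)) X]
    (c c' : Simplex1 X →₀ ℤ) : Prop :=
  ∃ b : Simplex2 X →₀ ℤ, c' - c = boundary2 b

/-- The image of a `1`-simplex by a diffeomorphism. -/
def Simplex1.map {X : Type*} [TopologicalSpace X] [ChartedSpace (EuclideanSpace ℝ (Fin 2)) X]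
    (φ : X ≃ₘ^∞⟮𝓡 2, 𝓡 2⟯ X) (γ : Simplex1 X) : Simplex1 X :=
  ⟨fun t => φ (γ.1 t), by
    obtain ⟨g, hg, h⟩ := γ.2
    exact ⟨fun t => φ (g t), fun t ht => (φ.contMDiff (g t)).comp t (hg t ht),
      fun t => congrArg φ (h t)⟩⟩

/-- The image of a `1`-chain by a diffeomorphism. -/
def pushforward {X : Type*} [TopologicalSpace X] [ChartedSpace (EuclideanSpace ℝ (Fin 2)) X]
    (φ : X ≃ₘ^∞⟮𝓡 2, 𝓡 2⟯ X) (c : Simplex1 X →₀ ℤ) : Simplex1 X →₀ ℤ :=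
  Finsupp.mapDomain (Simplex1.map φ) c

/-- The integral `∫_c θ` of a `1`-form along a `1`-chain. The simplices are extended by constants
outside `[0, 1]`. -/
def integral {X : Type*} [TopologicalSpace X] [ChartedSpace (EuclideanSpace ℝ (Fin 2)) X]
    (θ : (p : X) → TangentSpace (𝓡 2) p → ℝ) (c : Simplex1 X →₀ ℤ) : ℝ :=
  c.sum fun γ n => (n : ℝ) * ∫ t in (0 : ℝ)..1,
    θ (IccExtend zero_le_one γ.1 t)
      (mfderiv 𝓘(ℝ, ℝ) (𝓡 2) (IccExtend zero_le_one γ.1) t (1 : ℝ))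

/-- The `1`-form `θ` is exact, i.e. it vanishes in the de Rham group `H¹(X)`. -/
def IsExact {X : Type*} [TopologicalSpace X] [ChartedSpace (EuclideanSpace ℝ (Fin 2)) X]
    (θ : (p : X) → TangentSpace (𝓡 2) p → ℝ) : Prop :=
  ∃ h : X → ℝ, ContMDiff (𝓡 2) 𝓘(ℝ, ℝ) ∞ h ∧
    ∀ p, ∀ v : TangentSpace (𝓡 2) p, θ p v = mfderiv (𝓡 2) 𝓘(ℝ, ℝ) h p v

/-- The Noether invariant `σ_S(c)` of the cycle `c`. -/
def noetherInvariant (κ H : ℝ) {X : Type*} [TopologicalSpace X]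
    [ChartedSpace (EuclideanSpace ℝ (Fin 2)) X] (f N : X → ℂ × ℝ) (S F : ℂ × ℝ → ℂ × ℝ)
    (c : Simplex1 X →₀ ℤ) : ℝ :=
  integral (noetherForm κ H f N S F) c

/-- `μ_S = 0`: the pulled-back Noether form vanishes in `H¹`, and all its periods vanish. -/
def NoetherVanishes (κ H : ℝ) {X : Type*} [TopologicalSpace X]
    [ChartedSpace (EuclideanSpace ℝ (Fin 2)) X] (f N : X → ℂ × ℝ) (S F : ℂ × ℝ → ℂ × ℝ) : Prop :=
  IsExact (noetherForm κ H f N S F) ∧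
    ∀ c : Simplex1 X →₀ ℤ, IsCycle c → noetherInvariant κ H f N S F c = 0

end NoetherE3

end

open NoetherE3

/-! Each of the three Killing fields S is horizontal and has a hamiltonian h with ∇_u S = κ h J u,
where J is the horizontal quarter turn, and with dh = vol(S, ·, ∂₃). Hence h ∂₃ is a potential
vector of S. The model domain is convex, so any other potential vector differs from it by a
gradient, which changes the Noether form by an exact form. It is therefore enough to treat the form
built from h ∂₃ (`verticalForm`).

This form is closed on a surface of constant mean curvature. In its differential, the derivative of
N gives 2H vol(S, df, df), the derivative of S gives a multiple of the trace-free term coming from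
J, which vanishes, and the potential cancels the first contribution (`fderiv_pulledForm_symm`).
Integrals over homologous chains thus agree.

Invariance under a single isometry Φ: the pull-back of the Noether form of S is the Noether form of
the pulled-back field. The two fields in question span a plane preserved by Φ, on which it acts by a
matrix M. If a cycle is homologous to its image, the pair of its invariants is fixed by M. As det(M
- I) ≠ 0, both vanish (`noetherInvariant_eq_zero_of_homologous`).

Invariance under a whole family of translations: the generator S is tangent to the surface
(`metric_generator_eq_zero_of_invariant`). No continuity of t ↦ φ_t is assumed; uncountability of
the set of parameters provides an accumulation that replaces it. Once S is tangent, for any other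
Killing field T of the list the function vol(N, T, S) has as differential the Noether form of the
bracket [S, T] (`fderiv_vol_fields`). The brackets [S₁, S_R] = S₂, [S₂, S_R] = -S₁ and [S₁, S₂] = -κ
S_R then give global primitives; recovering S_R needs κ ≠ 0. -/

open NoetherE3

/-! ### The ambient space: linear algebra of the metric and of the volume form -/

section Ambient

/-- The vertical unit field `∂₃`. -/
def vertical : ℂ × ℝ := (0, 1)

theorem vol_eq (κ : ℝ) (p u v w : ℂ × ℝ) :
    vol κ p u v w = conf κ p ^ 2 *
      (u.1.re * v.1.im * w.2 - u.1.re * v.2 * w.1.im - u.1.im * v.1.re * w.2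
        + u.1.im * v.2 * w.1.re + u.2 * v.1.re * w.1.im - u.2 * v.1.im * w.1.re) := by
  simp [vol, Matrix.det_fin_three]

/-- The Christoffel tensor of the metric. -/
noncomputable def chris (κ : ℝ) (p u v : ℂ × ℝ) : ℂ × ℝ :=
  (((-(κ / 2) * conf κ p) : ℝ) • ((p.1.re * u.1.re + p.1.im * u.1.im) • v.1
    + (p.1.re * v.1.re + p.1.im * v.1.im) • u.1
    - (u.1.re * v.1.re + u.1.im * v.1.im) • p.1), 0)

theorem space_pos {κ : ℝ} {p : ℂ × ℝ} (hp : p ∈ space κ) : 0 < 1 + κ / 4 * ‖p.1‖ ^ 2 := by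
  rcases le_or_gt 0 κ with h | h
  · positivity
  · have h1 : ‖p.1‖ < 2 / Real.sqrt |κ| := hp h
    have hk : 0 < |κ| := abs_pos.2 h.ne
    have h2 : ‖p.1‖ ^ 2 < (2 / Real.sqrt |κ|) ^ 2 := by gcongr
    rw [div_pow, Real.sq_sqrt hk.le, lt_div_iff₀ hk, abs_of_neg h] at h2
    linarith

theorem isOpen_space (κ : ℝ) : IsOpen (space κ) := by
  by_cases h : κ < 0
  · simpa [space, h] using isOpen_lt (continuous_fst.norm) continuous_const
  · simp [space, h]

/-- Convexity makes the Poincaré lemma available on the whole model domain, so that the difference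
of two potential vectors is a global gradient. -/
theorem convex_space (κ : ℝ) : Convex ℝ (space κ) := by
  by_cases h : κ < 0
  · have : space κ = Metric.ball (0 : ℂ) (2 / Real.sqrt |κ|) ×ˢ univ := by
      ext p; simp [space, h]
    rw [this]
    exact (convex_ball _ _).prod convex_univ
  · simpa [space, h] using convex_univ

theorem conf_pos {κ : ℝ} {p : ℂ × ℝ} (hp : p ∈ space κ) : 0 < conf κ p :=
  one_div_pos.2 (space_pos hp)

theorem conf_eq (κ : ℝ) (p : ℂ × ℝ) :
    conf κ p = 1 / (1 + κ / 4 * (p.1.re ^ 2 + p.1.im ^ 2)) := by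
  rw [conf, ← Complex.normSq_eq_norm_sq, Complex.normSq_apply]; ring_nf

/-- This relation turns the identities between Killing fields, hamiltonians and Christoffel terms
below into polynomial identities modulo one equation. -/
theorem conf_mul {κ : ℝ} {p : ℂ × ℝ} (hp : p ∈ space κ) :
    conf κ p * (1 + κ / 4 * (p.1.re ^ 2 + p.1.im ^ 2)) = 1 := by
  have := space_pos hp
  rw [← Complex.normSq_eq_norm_sq, Complex.normSq_apply] at this
  rw [conf_eq]
  have h : 1 + κ / 4 * (p.1.re ^ 2 + p.1.im ^ 2) ≠ 0 := by
    apply ne_of_gt; linarith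
  rw [one_div, inv_mul_cancel₀ h]

theorem hasDerivAt_re {f : ℝ → ℂ × ℝ} {f' : ℂ × ℝ} {t : ℝ} (hf : HasDerivAt f f' t) :
    HasDerivAt (fun s => (f s).1.re) f'.1.re t :=
  (Complex.reCLM.comp (ContinuousLinearMap.fst ℝ ℂ ℝ)).hasFDerivAt.comp_hasDerivAt t hf

theorem hasDerivAt_im {f : ℝ → ℂ × ℝ} {f' : ℂ × ℝ} {t : ℝ} (hf : HasDerivAt f f' t) :
    HasDerivAt (fun s => (f s).1.im) f'.1.im t :=
  (Complex.imCLM.comp (ContinuousLinearMap.fst ℝ ℂ ℝ)).hasFDerivAt.comp_hasDerivAt t hf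

theorem hasDerivAt_snd' {f : ℝ → ℂ × ℝ} {f' : ℂ × ℝ} {t : ℝ} (hf : HasDerivAt f f' t) :
    HasDerivAt (fun s => (f s).2) f'.2 t :=
  (ContinuousLinearMap.snd ℝ ℂ ℝ).hasFDerivAt.comp_hasDerivAt t hf

theorem hasDerivAt_conf {κ : ℝ} {f : ℝ → ℂ × ℝ} {f' : ℂ × ℝ} {t : ℝ} (hf : HasDerivAt f f' t)
    (ht : f t ∈ space κ) :
    HasDerivAt (fun s => conf κ (f s))
      (-(κ / 2) * conf κ (f t) ^ 2 * ((f t).1.re * f'.1.re + (f t).1.im * f'.1.im)) t := by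
  have h := conf_mul ht
  simp only [conf_eq] at h ⊢
  have hne : 1 + κ / 4 * ((f t).1.re ^ 2 + (f t).1.im ^ 2) ≠ 0 := by
    intro h0; rw [h0] at h; simp at h
  have := (((((hasDerivAt_re hf).fun_pow 2).fun_add ((hasDerivAt_im hf).fun_pow 2)).const_mul
    (κ / 4)).const_add 1).fun_inv hne
  simp only [one_div]
  refine this.congr_deriv ?_
  generalize 1 + κ / 4 * ((f t).1.re ^ 2 + (f t).1.im ^ 2) = c
  simp only [div_eq_mul_inv, Nat.cast_ofNat, inv_pow]
  ring

/-- The derivative of λ² is split evenly between the two arguments as Christoffel corrections; this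
is metric compatibility along a curve. Working along curves gives all directional derivatives at
once. -/
theorem hasDerivAt_metric {κ : ℝ} {f a b : ℝ → ℂ × ℝ} {f' a' b' : ℂ × ℝ} {t : ℝ}
    (hf : HasDerivAt f f' t) (ha : HasDerivAt a a' t) (hb : HasDerivAt b b' t)
    (ht : f t ∈ space κ) :
    HasDerivAt (fun s => metric κ (f s) (a s) (b s))
      (metric κ (f t) (a' + chris κ (f t) f' (a t)) (b t)
        + metric κ (f t) (a t) (b' + chris κ (f t) f' (b t))) t := by
  have := (((hasDerivAt_conf hf ht).fun_pow 2).fun_mul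
    (((hasDerivAt_re ha).fun_mul (hasDerivAt_re hb)).fun_add
      ((hasDerivAt_im ha).fun_mul (hasDerivAt_im hb)))).fun_add
    ((hasDerivAt_snd' ha).fun_mul (hasDerivAt_snd' hb))
  simp only [metric]
  refine this.congr_deriv ?_
  simp [chris]
  ring

theorem hasDerivAt_vol {κ : ℝ} {f a b c : ℝ → ℂ × ℝ} {f' a' b' c' : ℂ × ℝ} {t : ℝ}
    (hf : HasDerivAt f f' t) (ha : HasDerivAt a a' t) (hb : HasDerivAt b b' t)
    (hc : HasDerivAt c c' t) (ht : f t ∈ space κ) :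
    HasDerivAt (fun s => vol κ (f s) (a s) (b s) (c s))
      (vol κ (f t) (a' + chris κ (f t) f' (a t)) (b t) (c t)
        + vol κ (f t) (a t) (b' + chris κ (f t) f' (b t)) (c t)
        + vol κ (f t) (a t) (b t) (c' + chris κ (f t) f' (c t))) t := by
  have ha1 := hasDerivAt_re ha
  have ha2 := hasDerivAt_im ha
  have ha3 := hasDerivAt_snd' ha
  have hb1 := hasDerivAt_re hb
  have hb2 := hasDerivAt_im hb
  have hb3 := hasDerivAt_snd' hb
  have hc1 := hasDerivAt_re hc
  have hc2 := hasDerivAt_im hc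
  have hc3 := hasDerivAt_snd' hc
  have := ((hasDerivAt_conf hf ht).fun_pow 2).fun_mul
    ((((((((ha1.fun_mul hb2).fun_mul hc3).fun_sub ((ha1.fun_mul hb3).fun_mul hc2)).fun_sub
      ((ha2.fun_mul hb1).fun_mul hc3)).fun_add ((ha2.fun_mul hb3).fun_mul hc1)).fun_add
      ((ha3.fun_mul hb1).fun_mul hc2)).fun_sub ((ha3.fun_mul hb2).fun_mul hc1)))
  simp only [vol_eq]
  refine this.congr_deriv ?_
  simp [chris]
  ring

variable {E : Type*} [NormedAddCommGroup E] [NormedSpace ℝ E]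

theorem hasLineDerivAt_of_differentiableAt {G : Type*} [NormedAddCommGroup G] [NormedSpace ℝ G]
    {f : E → G} {y : E} (hf : DifferentiableAt ℝ f y) (u : E) :
    HasDerivAt (fun t : ℝ => f (y + t • u)) (fderiv ℝ f y u) 0 :=
  hf.hasFDerivAt.hasLineDerivAt u

/-- Once differentiability is known, a Fréchet derivative is computed by restriction to a line,
where the one-variable formulas above apply. -/
theorem fderiv_apply_eq_of_hasDerivAt {G : Type*} [NormedAddCommGroup G] [NormedSpace ℝ G]
    {f : E → G} {y u : E} {d : G} (hf : DifferentiableAt ℝ f y)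
    (h : HasDerivAt (fun t : ℝ => f (y + t • u)) d 0) : fderiv ℝ f y u = d :=
  (hasLineDerivAt_of_differentiableAt hf u).unique h

theorem contDiffAt_conf {n : WithTop ℕ∞} {κ : ℝ} {f : E → ℂ × ℝ} {y : E}
    (hf : ContDiffAt ℝ n f y) (hy : f y ∈ space κ) : ContDiffAt ℝ n (fun z => conf κ (f z)) y := by
  unfold conf
  refine contDiffAt_const.div ?_ (space_pos hy).ne'
  exact contDiffAt_const.add (contDiffAt_const.mul (hf.fst.norm_sq ℝ))

theorem contDiffAt_re {n : WithTop ℕ∞} {f : E → ℂ × ℝ} {y : E}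
    (hf : ContDiffAt ℝ n f y) : ContDiffAt ℝ n (fun z => (f z).1.re) y :=
  (Complex.reCLM.comp (ContinuousLinearMap.fst ℝ ℂ ℝ)).contDiff.contDiffAt.comp y hf

theorem contDiffAt_im {n : WithTop ℕ∞} {f : E → ℂ × ℝ} {y : E}
    (hf : ContDiffAt ℝ n f y) : ContDiffAt ℝ n (fun z => (f z).1.im) y :=
  (Complex.imCLM.comp (ContinuousLinearMap.fst ℝ ℂ ℝ)).contDiff.contDiffAt.comp y hf

theorem contDiffAt_metric {n : WithTop ℕ∞} {κ : ℝ} {f a b : E → ℂ × ℝ} {y : E}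
    (hf : ContDiffAt ℝ n f y) (ha : ContDiffAt ℝ n a y) (hb : ContDiffAt ℝ n b y)
    (hy : f y ∈ space κ) : ContDiffAt ℝ n (fun z => metric κ (f z) (a z) (b z)) y :=
  (((contDiffAt_conf hf hy).pow 2).mul (((contDiffAt_re ha).mul (contDiffAt_re hb)).add
    ((contDiffAt_im ha).mul (contDiffAt_im hb)))).add (ha.snd.mul hb.snd)

theorem contDiffAt_vol {n : WithTop ℕ∞} {κ : ℝ} {f a b c : E → ℂ × ℝ} {y : E}
    (hf : ContDiffAt ℝ n f y) (ha : ContDiffAt ℝ n a y) (hb : ContDiffAt ℝ n b y)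
    (hc : ContDiffAt ℝ n c y) (hy : f y ∈ space κ) :
    ContDiffAt ℝ n (fun z => vol κ (f z) (a z) (b z) (c z)) y := by
  have ha1 := contDiffAt_re ha
  have ha2 := contDiffAt_im ha
  have hb1 := contDiffAt_re hb
  have hb2 := contDiffAt_im hb
  have hc1 := contDiffAt_re hc
  have hc2 := contDiffAt_im hc
  simp only [vol_eq]
  exact ((contDiffAt_conf hf hy).pow 2).mul
    ((((((((ha1.mul hb2).mul hc.snd).sub ((ha1.mul hb.snd).mul hc2)).sub
      ((ha2.mul hb1).mul hc.snd)).add ((ha2.mul hb.snd).mul hc1)).add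
      ((ha.snd.mul hb1).mul hc2)).sub ((ha.snd.mul hb2).mul hc1)))

/-- Compatibility of the connection with the metric, along a map. -/
theorem fderiv_metric {κ : ℝ} {f a b : E → ℂ × ℝ} {y : E}
    (hf : ContDiffAt ℝ 1 f y) (ha : ContDiffAt ℝ 1 a y) (hb : ContDiffAt ℝ 1 b y)
    (hy : f y ∈ space κ) (u : E) :
    fderiv ℝ (fun z => metric κ (f z) (a z) (b z)) y u
      = metric κ (f y) (fderiv ℝ a y u + chris κ (f y) (fderiv ℝ f y u) (a y)) (b y)
        + metric κ (f y) (a y) (fderiv ℝ b y u + chris κ (f y) (fderiv ℝ f y u) (b y)) := by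
  refine fderiv_apply_eq_of_hasDerivAt
    ((contDiffAt_metric hf ha hb hy).differentiableAt one_ne_zero) ?_
  have h := fun {g : E → ℂ × ℝ} (hg : ContDiffAt ℝ 1 g y) =>
    hasLineDerivAt_of_differentiableAt (hg.differentiableAt one_ne_zero) u
  simpa using hasDerivAt_metric (κ := κ) (h hf) (h ha) (h hb) (by simpa using hy)

/-- The volume form is parallel, along a map. -/
theorem fderiv_vol {κ : ℝ} {f a b c : E → ℂ × ℝ} {y : E}
    (hf : ContDiffAt ℝ 1 f y) (ha : ContDiffAt ℝ 1 a y) (hb : ContDiffAt ℝ 1 b y)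
    (hc : ContDiffAt ℝ 1 c y) (hy : f y ∈ space κ) (u : E) :
    fderiv ℝ (fun z => vol κ (f z) (a z) (b z) (c z)) y u
      = vol κ (f y) (fderiv ℝ a y u + chris κ (f y) (fderiv ℝ f y u) (a y)) (b y) (c y)
        + vol κ (f y) (a y) (fderiv ℝ b y u + chris κ (f y) (fderiv ℝ f y u) (b y)) (c y)
        + vol κ (f y) (a y) (b y) (fderiv ℝ c y u + chris κ (f y) (fderiv ℝ f y u) (c y)) := by
  refine fderiv_apply_eq_of_hasDerivAt
    ((contDiffAt_vol hf ha hb hc hy).differentiableAt one_ne_zero) ?_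
  have h := fun {g : E → ℂ × ℝ} (hg : ContDiffAt ℝ 1 g y) =>
    hasLineDerivAt_of_differentiableAt (hg.differentiableAt one_ne_zero) u
  simpa using hasDerivAt_vol (κ := κ) (h hf) (h ha) (h hb) (h hc) (by simpa using hy)

theorem chris_comm (κ : ℝ) (p u v : ℂ × ℝ) : chris κ p u v = chris κ p v u := by
  simp only [chris, Prod.mk.injEq, and_true]
  rw [add_comm ((p.1.re * u.1.re + p.1.im * u.1.im) • v.1), mul_comm u.1.re, mul_comm u.1.im]

/-- The tensor `chris` is symmetric and compatible with the metric, so the Koszul combination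
reduces to it. This links the definition of mean curvature to the explicit connection. -/
theorem christoffel_eq {κ : ℝ} {p : ℂ × ℝ} (hp : p ∈ space κ) (u v w : ℂ × ℝ) :
    christoffel κ p u v w = metric κ p (chris κ p u v) w := by
  have h (a b c : ℂ × ℝ) : fderiv ℝ (fun q => metric κ q a b) p c
      = metric κ p (chris κ p c a) b + metric κ p a (chris κ p c b) := by
    simpa using fderiv_metric (κ := κ) (f := fun q => q) (a := fun _ => a) (b := fun _ => b)
      (y := p) contDiffAt_id contDiffAt_const contDiffAt_const hp c
  rw [christoffel, h, h, h]
  simp [metric, chris]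
  ring

end Ambient

/-! ### Pointwise algebra of the metric, the volume form and the shape operator -/

section Pointwise

theorem metric_comm (κ : ℝ) (p u v : ℂ × ℝ) : metric κ p u v = metric κ p v u := by
  simp only [metric]; ring

theorem metric_add_left (κ : ℝ) (p u v w : ℂ × ℝ) :
    metric κ p (u + v) w = metric κ p u w + metric κ p v w := by
  simp [metric]; ring

theorem metric_add_right (κ : ℝ) (p u v w : ℂ × ℝ) :
    metric κ p w (u + v) = metric κ p w u + metric κ p w v := by
  simp [metric]; ring

theorem metric_smul_left (κ c : ℝ) (p u v : ℂ × ℝ) :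
    metric κ p (c • u) v = c * metric κ p u v := by
  simp [metric]; ring

theorem metric_smul_right (κ c : ℝ) (p u v : ℂ × ℝ) :
    metric κ p u (c • v) = c * metric κ p u v := by
  simp [metric]; ring

theorem metric_self_eq_zero {κ : ℝ} {p : ℂ × ℝ} (hp : p ∈ space κ) {u : ℂ × ℝ}
    (h : metric κ p u u = 0) : u = 0 := by
  have hc := pow_pos (conf_pos hp) 2
  simp only [metric] at h
  have h1 : 0 ≤ conf κ p ^ 2 * (u.1.re * u.1.re + u.1.im * u.1.im) := by
    have := mul_self_nonneg u.1.re
    have := mul_self_nonneg u.1.im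
    positivity
  have h2 := mul_self_nonneg u.2
  have h3 : conf κ p ^ 2 * (u.1.re * u.1.re + u.1.im * u.1.im) = 0 := by linarith
  have h4 : u.2 * u.2 = 0 := by linarith
  have h5 := (mul_eq_zero.1 h3).resolve_left hc.ne'
  have h6 : u.1 = 0 := Complex.normSq_eq_zero.1 (by rw [Complex.normSq_apply]; exact h5)
  exact Prod.ext h6 (mul_self_eq_zero.1 h4)

/-- The product of two volumes is the Gram determinant. -/
theorem vol_mul_vol (κ : ℝ) (p a b c x y z : ℂ × ℝ) :
    vol κ p a b c * vol κ p x y z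
      = metric κ p a x * (metric κ p b y * metric κ p c z - metric κ p b z * metric κ p c y)
        - metric κ p a y * (metric κ p b x * metric κ p c z - metric κ p b z * metric κ p c x)
        + metric κ p a z * (metric κ p b x * metric κ p c y - metric κ p b y * metric κ p c x) := by
  simp only [vol_eq, metric]; ring

/-- The quarter turn of the horizontal plane. -/
noncomputable def turn (u : ℂ × ℝ) : ℂ × ℝ := (⟨-u.1.im, u.1.re⟩, 0)

/-- The quarter turn is skew for the metric. Being trace-free, it also annihilates the volume form
as a derivation, which is the next identity. -/
theorem metric_turn (κ : ℝ) (p u v : ℂ × ℝ) :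
    metric κ p (turn u) v + metric κ p u (turn v) = 0 := by
  simp [metric, turn]; ring

theorem vol_turn (κ : ℝ) (p u v w : ℂ × ℝ) :
    vol κ p (turn u) v w + vol κ p u (turn v) w + vol κ p u v (turn w) = 0 := by
  simp [vol_eq, turn]; ring

local notation "E2" => EuclideanSpace ℝ (Fin 2)
local notation "e₀" => (EuclideanSpace.single (0 : Fin 2) (1 : ℝ))
local notation "e₁" => (EuclideanSpace.single (1 : Fin 2) (1 : ℝ))

/-- The first order data at `p` of an oriented surface of mean curvature `H` with normal `n`:
the differential `A` of the immersion, and the covariant differential `B` of the normal. -/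
structure IsShape (κ H : ℝ) (p n : ℂ × ℝ) (A B : E2 →L[ℝ] ℂ × ℝ) : Prop where
  unit : metric κ p n n = 1
  normal : ∀ v, metric κ p n (A v) = 0
  normal_deriv : ∀ v, metric κ p n (B v) = 0
  symm : ∀ u v, metric κ p (B u) (A v) = metric κ p (B v) (A u)
  nondeg : vol κ p n (A e₀) (A e₁) ≠ 0
  trace : -(metric κ p (B e₀) (A e₀) * metric κ p (A e₁) (A e₁)
      - 2 * metric κ p (B e₀) (A e₁) * metric κ p (A e₀) (A e₁)
      + metric κ p (B e₁) (A e₁) * metric κ p (A e₀) (A e₀))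
    = 2 * H * (metric κ p (A e₀) (A e₀) * metric κ p (A e₁) (A e₁)
      - metric κ p (A e₀) (A e₁) ^ 2)

/-- The square of this volume is the Gram determinant of the tangent frame; if it vanished, the
frame would be dependent. -/
theorem vol_ne_zero_of_injective {κ : ℝ} {p n : ℂ × ℝ} (hp : p ∈ space κ)
    {A : E2 →L[ℝ] ℂ × ℝ} (hA : Function.Injective A) (hn : metric κ p n n = 1)
    (h : ∀ v, metric κ p n (A v) = 0) : vol κ p n (A e₀) (A e₁) ≠ 0 := by
  intro h0
  have hg := vol_mul_vol κ p n (A e₀) (A e₁) n (A e₀) (A e₁)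
  rw [h0, hn, h, h, metric_comm κ p (A e₁) (A e₀)] at hg
  set a := metric κ p (A e₀) (A e₀)
  set b := metric κ p (A e₀) (A e₁)
  set c := metric κ p (A e₁) (A e₁) with hc
  -- The squared length of this vector is c(ac - b²), that is, c times the Gram determinant assumed
  -- to vanish.
  have h1 : A (c • e₀ + (-b) • e₁) = 0 := by
    apply metric_self_eq_zero hp
    simp only [map_add, map_smul, metric_add_left, metric_add_right, metric_smul_left,
      metric_smul_right, metric_comm κ p (A e₁) (A e₀)]
    linear_combination -c * hg
  have h2 := hA (h1.trans (map_zero A).symm)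
  have h3 : c = 0 := by simpa using congrArg (fun x : E2 => x 0) h2
  have h4 : A e₁ = 0 := metric_self_eq_zero hp (hc ▸ h3)
  have h5 := hA (h4.trans (map_zero A).symm)
  simpa using congrArg (fun x : E2 => x 1) h5

theorem E2_eq (u : E2) : u = u 0 • e₀ + u 1 • e₁ := by
  ext i; fin_cases i <;> simp

namespace IsShape

variable {κ H : ℝ} {p n : ℂ × ℝ} {A B : E2 →L[ℝ] ℂ × ℝ}

/-- Multiplying by the nonzero volume of the adapted frame replaces every volume by Gram products.
The tangential part of s drops out, and its normal part is weighted by the trace of the shape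
operator. -/
theorem gauss_aux (h : IsShape κ H p n A B) (s : ℂ × ℝ) :
    vol κ p (B e₀) s (A e₁) - vol κ p (B e₁) s (A e₀) = 2 * H * vol κ p s (A e₀) (A e₁) := by
  apply mul_left_cancel₀ h.nondeg
  have h1 := vol_mul_vol κ p n (A e₀) (A e₁) (B e₀) s (A e₁)
  have h2 := vol_mul_vol κ p n (A e₀) (A e₁) (B e₁) s (A e₀)
  have h3 := vol_mul_vol κ p n (A e₀) (A e₁) s (A e₀) (A e₁)
  simp only [h.normal, h.normal_deriv, metric_comm κ p (A e₁) (A e₀), metric_comm κ p _ (B e₀),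
    metric_comm κ p _ (B e₁), h.symm e₁ e₀] at h1 h2 h3
  linear_combination h1 - h2 - 2 * H * h3 + metric κ p n s * h.trace

/-- The derivative of the normal contributes twice the mean curvature to the differential of
`vol (N, S, df)`. -/
theorem vol_normal (h : IsShape κ H p n A B) (s : ℂ × ℝ) (u v : E2) :
    vol κ p (B u) s (A v) - vol κ p (B v) s (A u) = 2 * H * vol κ p s (A u) (A v) := by
  have h0 := h.gauss_aux s
  rw [E2_eq u, E2_eq v]
  simp only [map_add, map_smul]
  have h1 : ∀ (a b c d : ℂ × ℝ) (x y z w : ℝ),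
      vol κ p (x • a + y • b) s (z • c + w • d) = x * z * vol κ p a s c + x * w * vol κ p a s d
        + y * z * vol κ p b s c + y * w * vol κ p b s d := by
    intros; simp [vol_eq]; ring
  have h2 : ∀ (a b : ℂ × ℝ) (x y z w : ℝ),
      vol κ p s (x • a + y • b) (z • a + w • b) = (x * w - y * z) * vol κ p s a b := by
    intros; simp [vol_eq]; ring
  rw [h1, h1, h2]
  linear_combination (u 0 * v 1 - u 1 * v 0) * h0

/-- The infinitesimal rotations of the horizontal plane contribute nothing to the differential of
`vol (N, S, df)`. -/
theorem vol_turn_tangent (h : IsShape κ H p n A B) (u v : E2) :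
    vol κ p n (turn (A u)) (A v) - vol κ p n (turn (A v)) (A u) = 0 := by
  apply mul_left_cancel₀ h.nondeg
  have h3 := vol_turn κ p n (A u) (A v)
  have h4 := vol_mul_vol κ p n (A e₀) (A e₁) (turn n) (A u) (A v)
  have h5 : vol κ p n (A u) (turn (A v)) = - vol κ p n (turn (A v)) (A u) := by
    simp only [vol_eq]; ring
  have h6 : metric κ p n (turn n) = 0 := by
    have := metric_turn κ p n n
    rw [metric_comm κ p (turn n)] at this
    linarith
  -- The turned normal is itself orthogonal to n, so its volume with two tangent vectors is zero.
  simp only [h.normal, h6] at h4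
  linear_combination vol κ p n (A e₀) (A e₁) * (h3 - h5) - h4

/-- A vector is determined by its products with the tangent vectors and the normal. -/
theorem vol_congr (h : IsShape κ H p n A B) {x y : ℂ × ℝ} (hn : metric κ p n x = metric κ p n y)
    (ht : ∀ v, metric κ p (A v) x = metric κ p (A v) y) (s t : ℂ × ℝ) :
    vol κ p x s t = vol κ p y s t := by
  apply mul_left_cancel₀ h.nondeg
  rw [vol_mul_vol, vol_mul_vol, hn, ht, ht]

/-- A vector orthogonal to the normal is tangent. -/
theorem exists_tangent (h : IsShape κ H p n A B) (hp : p ∈ space κ) {s : ℂ × ℝ}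
    (hs : metric κ p n s = 0) : ∃ v, A v = s := by
  set a := metric κ p (A e₀) (A e₀) with ha
  set b := metric κ p (A e₀) (A e₁) with hb
  set c := metric κ p (A e₁) (A e₁) with hc
  set d := a * c - b ^ 2 with hd
  have hg := vol_mul_vol κ p n (A e₀) (A e₁) n (A e₀) (A e₁)
  have hd0 : d ≠ 0 := by
    intro h0
    apply h.nondeg
    rw [h.unit, h.normal, h.normal, metric_comm κ p (A e₁) (A e₀), ← ha, ← hb, ← hc] at hg
    apply mul_self_eq_zero.1
    rw [hg]
    linear_combination h0
  set x := metric κ p (A e₀) s with hx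
  set y := metric κ p (A e₁) s with hy
  -- The coordinates come from Cramer's rule for the Gram matrix of the frame, applied to the
  -- products of s with the two frame vectors.
  refine ⟨((c * x - b * y) / d) • e₀ + ((a * y - b * x) / d) • e₁, ?_⟩
  rw [← sub_eq_zero]
  set z := A (((c * x - b * y) / d) • e₀ + ((a * y - b * x) / d) • e₁) - s with hz
  have hz' : z = ((c * x - b * y) / d) • A e₀ + ((a * y - b * x) / d) • A e₁ + (-1 : ℝ) • s := by
    rw [hz, map_add, map_smul, map_smul, neg_one_smul, sub_eq_add_neg]
  have hzn : metric κ p n z = 0 := by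
    simp only [hz', metric_add_right, metric_smul_right, h.normal, hs]
    ring
  have hz0 : metric κ p (A e₀) z = 0 := by
    simp only [hz', metric_add_right, metric_smul_right, ← ha, ← hb, ← hx]
    field_simp
    rw [hd]; ring
  have hz1 : metric κ p (A e₁) z = 0 := by
    simp only [hz', metric_add_right, metric_smul_right, metric_comm κ p (A e₁) (A e₀), ← hc,
      ← hb, ← hy]
    field_simp
    rw [hd]; ring
  -- The error z is orthogonal to the whole frame n, A e₀, A e₁, so all volumes containing it
  -- vanish. Testing on coordinate vectors then kills each component of z.
  have hv (s t : ℂ × ℝ) : vol κ p z s t = 0 := by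
    apply mul_left_cancel₀ h.nondeg
    rw [vol_mul_vol, hzn, hz0, hz1]; ring
  have hcp := pow_ne_zero 2 (conf_pos hp).ne'
  have e1 := hv (Complex.I, 0) (0, 1)
  have e2 := hv (1, 0) (0, 1)
  have e3 := hv (1, 0) (Complex.I, 0)
  simp [vol_eq, (conf_pos hp).ne'] at e1 e2 e3
  exact Prod.ext (Complex.ext e1 e2) e3

end IsShape

end Pointwise

/-! ### Killing fields, hamiltonians, potential vectors and brackets -/

section Momentum

/-- `S` is a horizontal Killing field whose contraction with the horizontal area form is `dh`. -/
structure IsMomentum (κ : ℝ) (S : ℂ × ℝ → ℂ × ℝ) (h : ℂ × ℝ → ℝ) : Prop where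
  smooth : ContDiff ℝ ∞ S
  horizontal : ∀ p, (S p).2 = 0
  smooth_ham : ContDiffOn ℝ ∞ h (space κ)
  nabla : ∀ p ∈ space κ, ∀ u, fderiv ℝ S p u + chris κ p u (S p) = (κ * h p) • turn u
  fderiv_ham : ∀ p ∈ space κ, ∀ u, fderiv ℝ h p u = vol κ p (S p) u vertical

/-- The hamiltonian of `S₁`. -/
noncomputable def ham1 (κ : ℝ) (p : ℂ × ℝ) : ℝ := conf κ p * p.1.im

/-- The hamiltonian of `S₂`. -/
noncomputable def ham2 (κ : ℝ) (p : ℂ × ℝ) : ℝ := -(conf κ p * p.1.re)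

/-- The hamiltonian of `S_R`. -/
noncomputable def hamR (κ : ℝ) (p : ℂ × ℝ) : ℝ :=
  conf κ p * (1 - κ / 4 * (p.1.re ^ 2 + p.1.im ^ 2)) / κ

/-- In the complex coordinate the generators are polynomials in w, which makes their derivatives
immediate. -/
theorem gen1_eq (κ : ℝ) (p : ℂ × ℝ) : gen1 κ p = (1 + (κ / 4 : ℝ) * p.1 ^ 2, 0) := by
  refine Prod.ext (Complex.ext ?_ ?_) rfl
  · simp [gen1, pow_two]
  · simp [gen1, pow_two]; ring

theorem gen2_eq (κ : ℝ) (p : ℂ × ℝ) :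
    gen2 κ p = (Complex.I * (1 - (κ / 4 : ℝ) * p.1 ^ 2), 0) := by
  refine Prod.ext (Complex.ext ?_ ?_) rfl
  · simp [gen2, pow_two]; ring
  · simp [gen2, pow_two]

theorem genR_eq (p : ℂ × ℝ) : genR p = (Complex.I * p.1, 0) := by
  refine Prod.ext (Complex.ext ?_ ?_) rfl <;> simp [genR]

theorem contDiff_gen1 (κ : ℝ) : ContDiff ℝ ∞ (gen1 κ) := by
  rw [funext (gen1_eq κ)]; fun_prop

theorem contDiff_gen2 (κ : ℝ) : ContDiff ℝ ∞ (gen2 κ) := by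
  rw [funext (gen2_eq κ)]; fun_prop

theorem contDiff_genR : ContDiff ℝ ∞ genR := by
  rw [funext genR_eq]; fun_prop

theorem hasDerivAt_line (p u : ℂ × ℝ) : HasDerivAt (fun t : ℝ => p + t • u) u 0 := by
  simpa using ((hasDerivAt_id (0 : ℝ)).smul_const u).const_add p

theorem hasDerivAt_line_fst (p u : ℂ × ℝ) : HasDerivAt (fun t : ℝ => (p + t • u).1) u.1 0 :=
  (ContinuousLinearMap.fst ℝ ℂ ℝ).hasFDerivAt.comp_hasDerivAt 0 (hasDerivAt_line p u)

theorem fderiv_gen1 (κ : ℝ) (p u : ℂ × ℝ) :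
    fderiv ℝ (gen1 κ) p u = ((κ / 4 : ℝ) * (2 * p.1 * u.1), 0) := by
  refine fderiv_apply_eq_of_hasDerivAt ((contDiff_gen1 κ).differentiable (by simp) p) ?_
  rw [funext (gen1_eq κ)]
  refine HasDerivAt.prodMk ?_ (hasDerivAt_const _ _)
  refine ((((hasDerivAt_line_fst p u).fun_pow 2).const_mul ((κ / 4 : ℝ) : ℂ)).const_add
    1).congr_deriv ?_
  simp

theorem fderiv_gen2 (κ : ℝ) (p u : ℂ × ℝ) :
    fderiv ℝ (gen2 κ) p u = (-(Complex.I * ((κ / 4 : ℝ) * (2 * p.1 * u.1))), 0) := by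
  refine fderiv_apply_eq_of_hasDerivAt ((contDiff_gen2 κ).differentiable (by simp) p) ?_
  rw [funext (gen2_eq κ)]
  refine HasDerivAt.prodMk ?_ (hasDerivAt_const _ _)
  refine (((((hasDerivAt_line_fst p u).fun_pow 2).const_mul ((κ / 4 : ℝ) : ℂ)).const_sub
    1).const_mul Complex.I).congr_deriv ?_
  simp

theorem fderiv_genR (p u : ℂ × ℝ) : fderiv ℝ genR p u = (Complex.I * u.1, 0) := by
  refine fderiv_apply_eq_of_hasDerivAt (contDiff_genR.differentiable (by simp) p) ?_
  rw [funext genR_eq]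
  exact HasDerivAt.prodMk ((hasDerivAt_line_fst p u).const_mul Complex.I) (hasDerivAt_const _ _)

theorem contDiffOn_conf (κ : ℝ) : ContDiffOn ℝ ∞ (conf κ) (space κ) := fun _ hp =>
  (contDiffAt_conf (f := fun q => q) contDiffAt_id hp).contDiffWithinAt

theorem contDiff_fst_re : ContDiff ℝ ∞ (fun p : ℂ × ℝ => p.1.re) :=
  (Complex.reCLM.comp (ContinuousLinearMap.fst ℝ ℂ ℝ)).contDiff

theorem contDiff_fst_im : ContDiff ℝ ∞ (fun p : ℂ × ℝ => p.1.im) :=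
  (Complex.imCLM.comp (ContinuousLinearMap.fst ℝ ℂ ℝ)).contDiff

theorem contDiffOn_ham1 (κ : ℝ) : ContDiffOn ℝ ∞ (ham1 κ) (space κ) :=
  (contDiffOn_conf κ).mul contDiff_fst_im.contDiffOn

theorem contDiffOn_ham2 (κ : ℝ) : ContDiffOn ℝ ∞ (ham2 κ) (space κ) :=
  ((contDiffOn_conf κ).mul contDiff_fst_re.contDiffOn).neg

theorem contDiffOn_hamR (κ : ℝ) : ContDiffOn ℝ ∞ (hamR κ) (space κ) :=
  ((contDiffOn_conf κ).mul (contDiff_const.sub (contDiff_const.mul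
    ((contDiff_fst_re.pow 2).add (contDiff_fst_im.pow 2)))).contDiffOn).div_const κ

theorem differentiableAt_of_contDiffOn_space {G : Type*} [NormedAddCommGroup G] [NormedSpace ℝ G]
    {κ : ℝ} {h : ℂ × ℝ → G} (hh : ContDiffOn ℝ ∞ h (space κ)) {p : ℂ × ℝ} (hp : p ∈ space κ) :
    DifferentiableAt ℝ h p :=
  (hh.contDiffAt ((isOpen_space κ).mem_nhds hp)).differentiableAt (by simp)

theorem isMomentum_gen1 (κ : ℝ) : IsMomentum κ (gen1 κ) (ham1 κ) where
  smooth := contDiff_gen1 κ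
  horizontal _ := rfl
  smooth_ham := contDiffOn_ham1 κ
  nabla p hp u := by
    have h := conf_mul hp
    rw [fderiv_gen1]
    refine Prod.ext (Complex.ext ?_ ?_) ?_
    · simp [chris, turn, gen1, ham1, pow_two]
      linear_combination (-κ / 2 * (p.1.re * u.1.re - p.1.im * u.1.im)) * h
    · simp [chris, turn, gen1, ham1, pow_two]
      linear_combination (-κ / 2 * (p.1.re * u.1.im + p.1.im * u.1.re)) * h
    · simp [chris, turn]
  fderiv_ham p hp u := by
    have h := conf_mul hp
    refine fderiv_apply_eq_of_hasDerivAt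
      (differentiableAt_of_contDiffOn_space (contDiffOn_ham1 κ) hp) ?_
    have hl := hasDerivAt_line p u
    refine ((hasDerivAt_conf (κ := κ) hl (by simpa using hp)).fun_mul
      (hasDerivAt_im hl)).congr_deriv ?_
    simp [vol_eq, gen1, vertical]
    linear_combination (-conf κ p * u.1.im) * h

theorem isMomentum_gen2 (κ : ℝ) : IsMomentum κ (gen2 κ) (ham2 κ) where
  smooth := contDiff_gen2 κ
  horizontal _ := rfl
  smooth_ham := contDiffOn_ham2 κ
  nabla p hp u := by
    have h := conf_mul hp
    rw [fderiv_gen2]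
    refine Prod.ext (Complex.ext ?_ ?_) ?_
    · simp [chris, turn, gen2, ham2, pow_two]
      linear_combination (-κ / 2 * (p.1.re * u.1.im + p.1.im * u.1.re)) * h
    · simp [chris, turn, gen2, ham2, pow_two]
      linear_combination (κ / 2 * (p.1.re * u.1.re - p.1.im * u.1.im)) * h
    · simp [chris, turn]
  fderiv_ham p hp u := by
    have h := conf_mul hp
    refine fderiv_apply_eq_of_hasDerivAt
      (differentiableAt_of_contDiffOn_space (contDiffOn_ham2 κ) hp) ?_
    have hl := hasDerivAt_line p u
    refine ((hasDerivAt_conf (κ := κ) hl (by simpa using hp)).fun_mul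
      (hasDerivAt_re hl)).fun_neg.congr_deriv ?_
    simp [vol_eq, gen2, vertical]
    linear_combination (conf κ p * u.1.re) * h

/-- The condition on dh determines the hamiltonian only up to a constant. The condition on ∇S fixes
that constant, since κ h must be the rotation coefficient; this is where division by κ enters. -/
theorem isMomentum_genR {κ : ℝ} (hκ : κ ≠ 0) : IsMomentum κ genR (hamR κ) where
  smooth := contDiff_genR
  horizontal _ := rfl
  smooth_ham := contDiffOn_hamR κ
  nabla p hp u := by
    have h := conf_mul hp
    have hh : κ * hamR κ p = conf κ p * (1 - κ / 4 * (p.1.re ^ 2 + p.1.im ^ 2)) := by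
      rw [hamR]; field_simp
    rw [fderiv_genR, hh]
    refine Prod.ext (Complex.ext ?_ ?_) ?_
    · simp [chris, turn, genR, pow_two]
      linear_combination u.1.im * h
    · simp [chris, turn, genR, pow_two]
      linear_combination (-u.1.re) * h
    · simp [chris, turn]
  fderiv_ham p hp u := by
    have h := conf_mul hp
    refine fderiv_apply_eq_of_hasDerivAt
      (differentiableAt_of_contDiffOn_space (contDiffOn_hamR κ) hp) ?_
    have hl := hasDerivAt_line p u
    refine (((hasDerivAt_conf (κ := κ) hl (by simpa using hp)).fun_mul
      (((((hasDerivAt_re hl).fun_pow 2).fun_add ((hasDerivAt_im hl).fun_pow 2)).const_mul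
        (κ / 4)).const_sub 1)).div_const κ).congr_deriv ?_
    rw [div_eq_iff hκ]
    simp [vol_eq, genR, vertical]
    linear_combination (conf κ p * (p.1.re * u.1.re + p.1.im * u.1.im) * κ / 2) * h

/-- The vertical field with component `h` is a potential vector of `S`. -/
theorem IsMomentum.isPotential_aux {κ : ℝ} {S : ℂ × ℝ → ℂ × ℝ} {h : ℂ × ℝ → ℝ}
    (hS : IsMomentum κ S h) {p : ℂ × ℝ} (hp : p ∈ space κ) (u v : ℂ × ℝ) :
    fderiv ℝ h p u * v.2 - fderiv ℝ h p v * u.2 = vol κ p (S p) u v := by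
  rw [hS.fderiv_ham p hp, hS.fderiv_ham p hp]
  simp [vol_eq, vertical, hS.horizontal]
  ring

/-- Any potential vector of `S` differs from the vertical one by a gradient. -/
theorem IsMomentum.exists_gradient {κ : ℝ} {S F : ℂ × ℝ → ℂ × ℝ} {h : ℂ × ℝ → ℝ}
    (hS : IsMomentum κ S h) (hF : IsPotential κ S F) :
    ∃ G : ℂ × ℝ → ℝ, ContDiffOn ℝ ∞ G (space κ) ∧
      ∀ p ∈ space κ, ∀ u, metric κ p (F p) u = h p * u.2 + fderiv ℝ G p u := by
  let dre : (ℂ × ℝ) →L[ℝ] ℝ := Complex.reCLM.comp (ContinuousLinearMap.fst ℝ ℂ ℝ)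
  let dim : (ℂ × ℝ) →L[ℝ] ℝ := Complex.imCLM.comp (ContinuousLinearMap.fst ℝ ℂ ℝ)
  let dz : (ℂ × ℝ) →L[ℝ] ℝ := ContinuousLinearMap.snd ℝ ℂ ℝ
  -- This is F♭ - h dx₃. It is closed because F and h ∂₃ have the same rotational S.
  let θ : ℂ × ℝ → (ℂ × ℝ) →L[ℝ] ℝ := fun p =>
    (conf κ p ^ 2 * (F p).1.re) • dre + (conf κ p ^ 2 * (F p).1.im) • dim
      + ((F p).2 - h p) • dz
  have hθ (p u : ℂ × ℝ) : θ p u = metric κ p (F p) u - h p * u.2 := by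
    simp [θ, dre, dim, dz, metric]; ring
  have hs : ContDiffOn ℝ ∞ θ (space κ) := by
    have hc := contDiffOn_conf κ
    have h1 : ContDiffOn ℝ ∞ (fun p => (F p).1.re) (space κ) :=
      dre.contDiff.comp_contDiffOn hF.1
    have h2 : ContDiffOn ℝ ∞ (fun p => (F p).1.im) (space κ) :=
      dim.contDiff.comp_contDiffOn hF.1
    exact ((((hc.pow 2).mul h1).smul contDiffOn_const).add
      (((hc.pow 2).mul h2).smul contDiffOn_const)).add
      ((hF.1.snd.sub hS.smooth_ham).smul contDiffOn_const)
  have hsym : ∀ p ∈ space κ, ∀ u v, fderiv ℝ θ p u v = fderiv ℝ θ p v u := by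
    intro p hp u v
    have hd := differentiableAt_of_contDiffOn_space hs hp
    have hdF := hF.1.contDiffAt ((isOpen_space κ).mem_nhds hp)
    have hdh := differentiableAt_of_contDiffOn_space hS.smooth_ham hp
    have key (u v : ℂ × ℝ) : fderiv ℝ θ p u v
        = fderiv ℝ (fun q => metric κ q (F q) v) p u - fderiv ℝ h p u * v.2 := by
      have e : fderiv ℝ θ p u v = fderiv ℝ (fun q => θ q v) p u := by
        rw [fderiv_clm_apply hd (differentiableAt_const v)]; simp
      have e2 : DifferentiableAt ℝ (fun q => metric κ q (F q) v) p :=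
        (contDiffAt_metric contDiffAt_id hdF contDiffAt_const hp).differentiableAt (by simp)
      rw [e, funext fun q => hθ q v, fderiv_fun_sub e2 (hdh.mul_const _),
        fderiv_mul_const hdh]
      simp [mul_comm]
    have h1 := hF.2 p hp u v
    have h2 := hS.isPotential_aux hp u v
    rw [key, key]
    linarith
  -- Poincaré lemma: symmetry of the derivative of θ on the convex open domain provides a primitive.
  obtain ⟨G, hG⟩ := (convex_space κ).exists_forall_hasFDerivAt_of_fderiv_symmetric
    (isOpen_space κ) (fun p hp => (differentiableAt_of_contDiffOn_space hs hp
      ).differentiableWithinAt) hsym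
  refine ⟨G, ?_, fun p hp u => ?_⟩
  · rw [contDiffOn_infty_iff_fderiv_of_isOpen (isOpen_space κ)]
    exact ⟨fun p hp => (hG p hp).differentiableAt.differentiableWithinAt,
      hs.congr fun p hp => (hG p hp).fderiv⟩
  · rw [(hG p hp).fderiv, hθ]; ring

/-- The Lie bracket relation `[S, T] = c U` between horizontal Killing fields, in terms of their
hamiltonians. -/
structure IsBracket (κ c : ℝ) (S T U : ℂ × ℝ → ℂ × ℝ) (hS hT hU : ℂ × ℝ → ℝ) : Prop where
  field : ∀ p ∈ space κ, (κ * hT p) • turn (S p) - (κ * hS p) • turn (T p) = c • U p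
  ham : ∀ p ∈ space κ, ∀ u, vol κ p (T p) (S p) u = c * hU p * u.2

/-- By the formula for ∇S, the difference ∇_S T - ∇_T S is κ h_T J S - κ h_S J T, so `field` is the
Lie bracket. The condition `ham` is the matching Poisson bracket and also fixes the additive
constant of the hamiltonian of U. -/
theorem bracket_1R {κ : ℝ} (hκ : κ ≠ 0) :
    IsBracket κ 1 (gen1 κ) genR (gen2 κ) (ham1 κ) (hamR κ) (ham2 κ) where
  field p hp := by
    have h := conf_mul hp
    have hh : κ * hamR κ p = conf κ p * (1 - κ / 4 * (p.1.re ^ 2 + p.1.im ^ 2)) := by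
      rw [hamR]; field_simp
    rw [hh]
    refine Prod.ext (Complex.ext ?_ ?_) ?_
    · simp [turn, gen1, genR, gen2, ham1, pow_two]
      linear_combination (κ / 2 * p.1.re * p.1.im) * h
    · simp [turn, gen1, genR, gen2, ham1, pow_two]
      linear_combination (1 - κ / 4 * (p.1.re ^ 2 - p.1.im ^ 2)) * h
    · simp [turn, gen2]
  ham p hp u := by
    have h := conf_mul hp
    simp [vol_eq, gen1, genR, ham2]
    linear_combination (-conf κ p * p.1.re * u.2) * h

theorem bracket_12 {κ : ℝ} (hκ : κ ≠ 0) :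
    IsBracket κ (-κ) (gen1 κ) (gen2 κ) genR (ham1 κ) (ham2 κ) (hamR κ) where
  field p hp := by
    have h := conf_mul hp
    refine Prod.ext (Complex.ext ?_ ?_) ?_
    · simp [turn, gen1, genR, gen2, ham1, ham2, pow_two]
      linear_combination (κ * p.1.im) * h
    · simp [turn, gen1, genR, gen2, ham1, ham2, pow_two]
      linear_combination (-κ * p.1.re) * h
    · simp [turn, genR]
  ham p hp u := by
    have h := conf_mul hp
    have hh : κ * hamR κ p = conf κ p * (1 - κ / 4 * (p.1.re ^ 2 + p.1.im ^ 2)) := by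
      rw [hamR]; field_simp
    rw [neg_mul, hh]
    simp [vol_eq, gen1, gen2]
    linear_combination (-conf κ p * (1 - κ / 4 * (p.1.re ^ 2 + p.1.im ^ 2)) * u.2) * h

theorem IsBracket.swap {κ c : ℝ} {S T U : ℂ × ℝ → ℂ × ℝ} {hS hT hU : ℂ × ℝ → ℝ}
    (h : IsBracket κ c S T U hS hT hU) : IsBracket κ (-c) T S U hT hS hU where
  field p hp := by rw [neg_smul, ← h.field p hp, neg_sub]
  ham p hp u := by
    have := h.ham p hp u
    rw [neg_mul, neg_mul, ← this]
    simp only [vol_eq]; ring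

theorem bracket_2R {κ : ℝ} (hκ : κ ≠ 0) :
    IsBracket κ (-1) (gen2 κ) genR (gen1 κ) (ham2 κ) (hamR κ) (ham1 κ) where
  field p hp := by
    have h := conf_mul hp
    have hh : κ * hamR κ p = conf κ p * (1 - κ / 4 * (p.1.re ^ 2 + p.1.im ^ 2)) := by
      rw [hamR]; field_simp
    rw [hh]
    refine Prod.ext (Complex.ext ?_ ?_) ?_
    · simp [turn, gen1, genR, gen2, ham2, pow_two]
      linear_combination (-1 - κ / 4 * (p.1.re ^ 2 - p.1.im ^ 2)) * h
    · simp [turn, gen1, genR, gen2, ham2, pow_two]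
      linear_combination (-κ / 2 * p.1.re * p.1.im) * h
    · simp [turn, gen1]
  ham p hp u := by
    have h := conf_mul hp
    simp [vol_eq, gen2, genR, ham1]
    linear_combination (-conf κ p * p.1.im * u.2) * h

end Momentum

/-! ### Möbius translations and rotations, and their action on the Killing fields -/

section Isometries

/-- `Φ` is at `x` infinitesimally a direct isometry: a similarity of ratio `m` on the horizontal
factor, compensated by the conformal factors, and the identity on the vertical one. -/
structure IsIsometryAt (κ : ℝ) (Φ : ℂ × ℝ → ℂ × ℝ) (x : ℂ × ℝ) (m : ℂ) : Prop where
  differentiableAt : DifferentiableAt ℝ Φ x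
  fderiv_apply : ∀ u, fderiv ℝ Φ x u = (m * u.1, u.2)
  conf_sq : conf κ (Φ x) ^ 2 * (m.re ^ 2 + m.im ^ 2) = conf κ x ^ 2

theorem IsIsometryAt.metric_map {κ : ℝ} {Φ : ℂ × ℝ → ℂ × ℝ} {x : ℂ × ℝ} {m : ℂ}
    (h : IsIsometryAt κ Φ x m) (u v : ℂ × ℝ) :
    metric κ (Φ x) (fderiv ℝ Φ x u) (fderiv ℝ Φ x v) = metric κ x u v := by
  simp only [h.fderiv_apply, metric, ← h.conf_sq, Complex.mul_re, Complex.mul_im]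
  ring

theorem IsIsometryAt.vol_map {κ : ℝ} {Φ : ℂ × ℝ → ℂ × ℝ} {x : ℂ × ℝ} {m : ℂ}
    (h : IsIsometryAt κ Φ x m) (u v w : ℂ × ℝ) :
    vol κ (Φ x) (fderiv ℝ Φ x u) (fderiv ℝ Φ x v) (fderiv ℝ Φ x w) = vol κ x u v w := by
  simp only [h.fderiv_apply, vol_eq, ← h.conf_sq, Complex.mul_re, Complex.mul_im]
  ring

/-- `Φ` is an isometry on `D`, and the pull-back by `Φ` of the field `S` with hamiltonian `h` is
the combination with coefficients `α`, `β` of the fields `Sa`, `Sb` with hamiltonians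
`ha`, `hb`. -/
def Intertwines (κ : ℝ) (Φ : ℂ × ℝ → ℂ × ℝ) (D : Set (ℂ × ℝ)) (S : ℂ × ℝ → ℂ × ℝ)
    (h : ℂ × ℝ → ℝ) (α : ℝ) (Sa : ℂ × ℝ → ℂ × ℝ) (ha : ℂ × ℝ → ℝ) (β : ℝ)
    (Sb : ℂ × ℝ → ℂ × ℝ) (hb : ℂ × ℝ → ℝ) : Prop :=
  ∀ x ∈ space κ, x ∈ D → ∃ m, IsIsometryAt κ Φ x m ∧
    S (Φ x) = fderiv ℝ Φ x (α • Sa x + β • Sb x) ∧ h (Φ x) = α * ha x + β * hb x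

/-- The Möbius transformation `w ↦ (τ + w) / (1 - (κ/4) τ̄ w)`, acting on the first factor. -/
noncomputable def mobius (κ : ℝ) (τ : ℂ) (p : ℂ × ℝ) : ℂ × ℝ :=
  ((τ + p.1) / (1 - (κ / 4 : ℝ) * (starRingEnd ℂ τ) * p.1), p.2)

theorem trans1_eq (κ t : ℝ) : trans1 κ t = mobius κ t := by
  funext p; simp [trans1, mobius]

/-- Both families of translations belong to one Möbius family, with τ = t and τ = it; the conjugate
of τ explains the opposite signs in their denominators. -/
theorem trans2_eq (κ t : ℝ) : trans2 κ t = mobius κ (Complex.I * t) := by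
  funext p
  simp only [trans2, mobius, map_mul, Complex.conj_I, Complex.conj_ofReal]
  congr 2
  ring

variable {κ : ℝ} {τ : ℂ} {p : ℂ × ℝ}

/-- The parameter `1 + (κ/4) |τ|²`. -/
noncomputable def mobiusNorm (κ : ℝ) (τ : ℂ) : ℝ := 1 + κ / 4 * (τ.re ^ 2 + τ.im ^ 2)

/-- The denominator of `mobius κ τ`. -/
noncomputable def mobiusDen (κ : ℝ) (τ : ℂ) (p : ℂ × ℝ) : ℂ :=
  1 - (κ / 4 : ℝ) * (starRingEnd ℂ τ) * p.1

theorem mobiusDen_re (κ : ℝ) (τ : ℂ) (p : ℂ × ℝ) :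
    (mobiusDen κ τ p).re = 1 - κ / 4 * (τ.re * p.1.re + τ.im * p.1.im) := by
  simp [mobiusDen]; ring

theorem mobiusDen_im (κ : ℝ) (τ : ℂ) (p : ℂ × ℝ) :
    (mobiusDen κ τ p).im = - (κ / 4 * (τ.re * p.1.im - τ.im * p.1.re)) := by
  simp [mobiusDen]; ring

theorem mobiusDen_normSq_pos (hD : mobiusDen κ τ p ≠ 0) :
    0 < (mobiusDen κ τ p).re ^ 2 + (mobiusDen κ τ p).im ^ 2 := by
  have := Complex.normSq_pos.2 hD
  rw [Complex.normSq_apply] at this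
  nlinarith

/-- The denominator is cleared through its squared modulus, so that later computations stay
polynomial and real. -/
theorem mobius_re (hD : mobiusDen κ τ p ≠ 0) :
    (mobius κ τ p).1.re * ((mobiusDen κ τ p).re ^ 2 + (mobiusDen κ τ p).im ^ 2)
      = (τ.re + p.1.re) * (mobiusDen κ τ p).re + (τ.im + p.1.im) * (mobiusDen κ τ p).im := by
  have h : (mobius κ τ p).1 * mobiusDen κ τ p = τ + p.1 := div_mul_cancel₀ _ hD
  have h1 := congrArg Complex.re h
  have h2 := congrArg Complex.im h
  simp only [Complex.mul_re, Complex.mul_im, Complex.add_re, Complex.add_im] at h1 h2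
  linear_combination (mobiusDen κ τ p).re * h1 + (mobiusDen κ τ p).im * h2

theorem mobius_im (hD : mobiusDen κ τ p ≠ 0) :
    (mobius κ τ p).1.im * ((mobiusDen κ τ p).re ^ 2 + (mobiusDen κ τ p).im ^ 2)
      = (τ.im + p.1.im) * (mobiusDen κ τ p).re - (τ.re + p.1.re) * (mobiusDen κ τ p).im := by
  have h : (mobius κ τ p).1 * mobiusDen κ τ p = τ + p.1 := div_mul_cancel₀ _ hD
  have h1 := congrArg Complex.re h
  have h2 := congrArg Complex.im h
  simp only [Complex.mul_re, Complex.mul_im, Complex.add_re, Complex.add_im] at h1 h2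
  linear_combination (mobiusDen κ τ p).re * h2 - (mobiusDen κ τ p).im * h1

/-- With D the denominator, the cross terms cancel in |D|² + (κ/4)|τ + w|² = (1 + (κ/4)|τ|²)(1 +
(κ/4)|w|²). -/
theorem conf_mobius (hp : p ∈ space κ) (hq : mobiusNorm κ τ ≠ 0) (hD : mobiusDen κ τ p ≠ 0) :
    conf κ (mobius κ τ p)
      = conf κ p * ((mobiusDen κ τ p).re ^ 2 + (mobiusDen κ τ p).im ^ 2) / mobiusNorm κ τ := by
  have hn := mobiusDen_normSq_pos hD
  have hc := conf_mul hp
  have h1 := mobius_re hD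
  have h2 := mobius_im hD
  set d := (mobiusDen κ τ p).re ^ 2 + (mobiusDen κ τ p).im ^ 2 with hd
  have hsum : ((mobius κ τ p).1.re ^ 2 + (mobius κ τ p).1.im ^ 2) * d
      = (τ.re + p.1.re) ^ 2 + (τ.im + p.1.im) ^ 2 := by
    apply mul_right_cancel₀ hn.ne'
    calc _ = ((mobius κ τ p).1.re * d) ^ 2 + ((mobius κ τ p).1.im * d) ^ 2 := by ring
      _ = _ := by rw [h1, h2, hd]; ring
  have hmain : (1 + κ / 4 * ((mobius κ τ p).1.re ^ 2 + (mobius κ τ p).1.im ^ 2)) * d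
      = mobiusNorm κ τ * (1 + κ / 4 * (p.1.re ^ 2 + p.1.im ^ 2)) := by
    calc _ = d + κ / 4 * (((mobius κ τ p).1.re ^ 2 + (mobius κ τ p).1.im ^ 2) * d) := by ring
      _ = _ := by rw [hsum, hd, mobiusDen_re, mobiusDen_im, mobiusNorm]; ring
  have hne : 1 + κ / 4 * ((mobius κ τ p).1.re ^ 2 + (mobius κ τ p).1.im ^ 2) ≠ 0 := by
    intro h0
    rw [h0, zero_mul] at hmain
    rcases mul_eq_zero.1 hmain.symm with h | h
    · exact hq h
    · rw [h, mul_zero] at hc; exact zero_ne_one hc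
  rw [conf_eq κ (mobius κ τ p), div_eq_div_iff hne hq]
  linear_combination (-conf κ p) * hmain - mobiusNorm κ τ * hc

/-- The derivative of `mobius κ τ` on the horizontal factor. -/
noncomputable def mobiusDeriv (κ : ℝ) (τ : ℂ) (p : ℂ × ℝ) : ℂ :=
  (mobiusNorm κ τ : ℂ) / mobiusDen κ τ p ^ 2

theorem isIsometryAt_mobius (hp : p ∈ space κ) (hq : mobiusNorm κ τ ≠ 0)
    (hD : mobiusDen κ τ p ≠ 0) :
    IsIsometryAt κ (mobius κ τ) p (mobiusDeriv κ τ p) := by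
  have hd : DifferentiableAt ℝ (mobius κ τ) p := by
    change DifferentiableAt ℝ (fun q : ℂ × ℝ =>
      ((τ + q.1) * (1 - (κ / 4 : ℝ) * (starRingEnd ℂ τ) * q.1)⁻¹, q.2)) p
    refine DifferentiableAt.prodMk (DifferentiableAt.fun_mul ?_ (DifferentiableAt.fun_inv ?_ hD))
      ?_ <;> fun_prop
  refine ⟨hd, fun u => ?_, ?_⟩
  · refine fderiv_apply_eq_of_hasDerivAt hd ?_
    refine HasDerivAt.prodMk ?_ (hasDerivAt_snd' (hasDerivAt_line p u))
    have h := hasDerivAt_line_fst p u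
    refine (HasDerivAt.fun_div (h.const_add τ)
      ((h.const_mul ((κ / 4 : ℝ) * (starRingEnd ℂ τ))).const_sub 1) ?_).congr_deriv ?_
    · simpa [mobiusDen] using hD
    · have e : (mobiusNorm κ τ : ℂ) = 1 + (κ / 4 : ℝ) * (τ * starRingEnd ℂ τ) := by
        rw [Complex.mul_conj, Complex.normSq_apply, mobiusNorm]
        push_cast; ring
      simp only [zero_smul, add_zero, mobiusDeriv, e, mobiusDen]
      ring
  · have hn := mobiusDen_normSq_pos hD
    have h1 : (mobiusDeriv κ τ p).re ^ 2 + (mobiusDeriv κ τ p).im ^ 2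
        = mobiusNorm κ τ ^ 2 / ((mobiusDen κ τ p).re ^ 2 + (mobiusDen κ τ p).im ^ 2) ^ 2 := by
      have := Complex.normSq_div (mobiusNorm κ τ : ℂ) (mobiusDen κ τ p ^ 2)
      rw [map_pow, Complex.normSq_ofReal, Complex.normSq_apply, Complex.normSq_apply] at this
      rw [mobiusDeriv]
      linear_combination this
    rw [h1, conf_mobius hp hq hD]
    field_simp

/-- Up to scaling, the three functions are the linear coordinates of the quadric (sphere or
hyperboloid) modelled by the metric. Isometries act linearly on them, so the right-hand sides are
linear in the same three functions at p. -/
theorem ham_mobius (hp : p ∈ space κ) (hq : mobiusNorm κ τ ≠ 0) (hD : mobiusDen κ τ p ≠ 0) :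
    conf κ (mobius κ τ p) * (mobius κ τ p).1.re
        = conf κ p * (τ.re * (1 - κ / 4 * (p.1.re ^ 2 + p.1.im ^ 2)) + p.1.re
          - κ / 4 * ((τ.re ^ 2 - τ.im ^ 2) * p.1.re + 2 * τ.re * τ.im * p.1.im))
          / mobiusNorm κ τ ∧
      conf κ (mobius κ τ p) * (mobius κ τ p).1.im
        = conf κ p * (τ.im * (1 - κ / 4 * (p.1.re ^ 2 + p.1.im ^ 2)) + p.1.im
          - κ / 4 * (2 * τ.re * τ.im * p.1.re - (τ.re ^ 2 - τ.im ^ 2) * p.1.im))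
          / mobiusNorm κ τ ∧
      conf κ (mobius κ τ p)
          * (1 - κ / 4 * ((mobius κ τ p).1.re ^ 2 + (mobius κ τ p).1.im ^ 2))
        = conf κ p * ((2 - mobiusNorm κ τ) * (1 - κ / 4 * (p.1.re ^ 2 + p.1.im ^ 2))
          - κ * (τ.re * p.1.re + τ.im * p.1.im)) / mobiusNorm κ τ := by
  have h1 := mobius_re hD
  have h2 := mobius_im hD
  have hn := mobiusDen_normSq_pos hD
  have hsum : ((mobius κ τ p).1.re ^ 2 + (mobius κ τ p).1.im ^ 2)
      * ((mobiusDen κ τ p).re ^ 2 + (mobiusDen κ τ p).im ^ 2)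
      = (τ.re + p.1.re) ^ 2 + (τ.im + p.1.im) ^ 2 := by
    apply mul_right_cancel₀ hn.ne'
    set d := (mobiusDen κ τ p).re ^ 2 + (mobiusDen κ τ p).im ^ 2 with hd
    calc _ = ((mobius κ τ p).1.re * d) ^ 2 + ((mobius κ τ p).1.im * d) ^ 2 := by ring
      _ = _ := by rw [h1, h2, hd]; ring
  rw [conf_mobius hp hq hD]
  refine ⟨?_, ?_, ?_⟩
  · rw [div_mul_eq_mul_div, mul_assoc, mul_comm _ (mobius κ τ p).1.re, h1, mobiusDen_re,
      mobiusDen_im]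
    ring
  · rw [div_mul_eq_mul_div, mul_assoc, mul_comm _ (mobius κ τ p).1.im, h2, mobiusDen_re,
      mobiusDen_im]
    ring
  · have : ((mobiusDen κ τ p).re ^ 2 + (mobiusDen κ τ p).im ^ 2)
        * (1 - κ / 4 * ((mobius κ τ p).1.re ^ 2 + (mobius κ τ p).1.im ^ 2))
        = (mobiusDen κ τ p).re ^ 2 + (mobiusDen κ τ p).im ^ 2
          - κ / 4 * ((τ.re + p.1.re) ^ 2 + (τ.im + p.1.im) ^ 2) := by
      rw [← hsum]; ring
    rw [div_mul_eq_mul_div, mul_assoc, this, mobiusDen_re, mobiusDen_im, mobiusNorm]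
    ring

theorem mobiusNorm_ofReal (κ t : ℝ) : mobiusNorm κ t = 1 + κ / 4 * t ^ 2 := by
  simp [mobiusNorm]

theorem mobiusNorm_I_mul (κ t : ℝ) : mobiusNorm κ (Complex.I * t) = 1 + κ / 4 * t ^ 2 := by
  simp [mobiusNorm]

variable {t : ℝ}

theorem mobiusDen_ne_zero_of_dom1 (hp : p ∈ dom1 κ t) : mobiusDen κ t p ≠ 0 := by
  simpa [mobiusDen, dom1] using hp

theorem mobiusDen_ne_zero_of_dom2 (hp : p ∈ dom2 κ t) : mobiusDen κ (Complex.I * t) p ≠ 0 := by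
  intro h0
  apply hp
  rw [← h0]
  simp only [mobiusDen, map_mul, Complex.conj_I, Complex.conj_ofReal]; ring

theorem param_ne_zero (ht : IsParam κ t) : 4 + κ * t ^ 2 ≠ 0 := by
  have : 0 < 1 + κ / 4 * t ^ 2 := ht
  apply ne_of_gt; linarith

theorem ofReal_param_ne_zero (ht : IsParam κ t) : 4 + (κ : ℂ) * (t : ℂ) ^ 2 ≠ 0 := by
  exact_mod_cast param_ne_zero ht

theorem intertwines_trans1_gen1 (ht : IsParam κ t) :
    Intertwines κ (trans1 κ t) (dom1 κ t) (gen1 κ) (ham1 κ) 1 (gen1 κ) (ham1 κ) 0 genR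
      (hamR κ) := by
  intro x hx hd
  have hD := mobiusDen_ne_zero_of_dom1 hd
  have hq : mobiusNorm κ t ≠ 0 := by rw [mobiusNorm_ofReal]; exact ht.ne'
  have hi := isIsometryAt_mobius hx hq hD
  have hh := ham_mobius hx hq hD
  rw [trans1_eq]
  refine ⟨_, hi, ?_, ?_⟩
  · rw [hi.fderiv_apply]
    simp only [gen1_eq, genR_eq, one_smul, zero_smul, add_zero]
    refine Prod.ext ?_ rfl
    simp only [mobiusDeriv, mobius, mobiusNorm_ofReal]
    rw [← mobiusDen]
    push_cast
    field_simp
    simp only [mobiusDen, Complex.conj_ofReal]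
    push_cast
    ring
  · rw [ham1, hh.2.1, div_eq_iff hq, mobiusNorm_ofReal]
    simp [ham1]
    ring

/-- Together with the next lemma this gives the action of the translation on the plane spanned by S₂
and S_R. The 2 × 2 matrix has determinant one, since (1 - (κ/4)t²)² + κt² = (1 + (κ/4)t²)². -/
theorem intertwines_trans1_gen2 (hκ : κ ≠ 0) (ht : IsParam κ t) :
    Intertwines κ (trans1 κ t) (dom1 κ t) (gen2 κ) (ham2 κ)
      ((1 - κ / 4 * t ^ 2) / (1 + κ / 4 * t ^ 2)) (gen2 κ) (ham2 κ)
      (-(κ * t) / (1 + κ / 4 * t ^ 2)) genR (hamR κ) := by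
  intro x hx hd
  have hD := mobiusDen_ne_zero_of_dom1 hd
  have hq : mobiusNorm κ t ≠ 0 := by rw [mobiusNorm_ofReal]; exact ht.ne'
  have hi := isIsometryAt_mobius hx hq hD
  have hh := ham_mobius hx hq hD
  have hQ := ofReal_param_ne_zero ht
  have hq' := param_ne_zero ht
  rw [trans1_eq]
  refine ⟨_, hi, ?_, ?_⟩
  · rw [hi.fderiv_apply]
    simp only [gen2_eq, genR_eq, Prod.smul_mk, Prod.mk_add_mk, Complex.real_smul,
      smul_zero, add_zero]
    refine Prod.ext ?_ rfl
    simp only [mobiusDeriv, mobius, mobiusNorm_ofReal]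
    rw [← mobiusDen]
    push_cast
    field_simp
    simp only [mobiusDen, Complex.conj_ofReal]
    push_cast
    ring
  · rw [ham2, hh.1, mobiusNorm_ofReal]
    simp [ham2, hamR]
    field_simp
    ring

theorem intertwines_trans1_genR (hκ : κ ≠ 0) (ht : IsParam κ t) :
    Intertwines κ (trans1 κ t) (dom1 κ t) genR (hamR κ)
      (t / (1 + κ / 4 * t ^ 2)) (gen2 κ) (ham2 κ)
      ((1 - κ / 4 * t ^ 2) / (1 + κ / 4 * t ^ 2)) genR (hamR κ) := by
  intro x hx hd
  have hD := mobiusDen_ne_zero_of_dom1 hd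
  have hq : mobiusNorm κ t ≠ 0 := by rw [mobiusNorm_ofReal]; exact ht.ne'
  have hi := isIsometryAt_mobius hx hq hD
  have hh := ham_mobius hx hq hD
  have hQ := ofReal_param_ne_zero ht
  rw [mul_comm] at hQ
  have hq' := param_ne_zero ht
  rw [trans1_eq]
  refine ⟨_, hi, ?_, ?_⟩
  · rw [hi.fderiv_apply]
    simp only [gen2_eq, genR_eq, Prod.smul_mk, Prod.mk_add_mk, Complex.real_smul,
      smul_zero, add_zero]
    refine Prod.ext ?_ rfl
    simp only [mobiusDeriv, mobius, mobiusNorm_ofReal]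
    rw [← mobiusDen]
    push_cast
    field_simp
    simp only [mobiusDen, Complex.conj_ofReal]
    push_cast
    ring
  · rw [hamR, hh.2.2, mobiusNorm_ofReal]
    simp [ham2, hamR]
    field_simp
    ring

theorem intertwines_trans2_gen2 (ht : IsParam κ t) :
    Intertwines κ (trans2 κ t) (dom2 κ t) (gen2 κ) (ham2 κ)
      (1) (gen2 κ) (ham2 κ)
      (0) genR (hamR κ) := by
  intro x hx hd
  have hD := mobiusDen_ne_zero_of_dom2 hd
  have hq : mobiusNorm κ (Complex.I * t) ≠ 0 := by rw [mobiusNorm_I_mul]; exact ht.ne'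
  have hi := isIsometryAt_mobius hx hq hD
  have hh := ham_mobius hx hq hD
  have hQ := ofReal_param_ne_zero ht
  have hq' := param_ne_zero ht
  rw [trans2_eq]
  refine ⟨_, hi, ?_, ?_⟩
  · rw [hi.fderiv_apply]
    simp only [gen2_eq, genR_eq, Prod.smul_mk, Prod.mk_add_mk, Complex.real_smul,
      smul_zero, add_zero]
    refine Prod.ext ?_ rfl
    simp only [mobiusDeriv, mobius, mobiusNorm_I_mul]
    rw [← mobiusDen]
    push_cast
    field_simp
    simp only [mobiusDen, Complex.conj_ofReal, map_mul, Complex.conj_I]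
    push_cast
    ring_nf
    simp only [Complex.I_sq]
    ring
  · rw [ham2, hh.1, mobiusNorm_I_mul]
    simp [ham2, hamR]
    field_simp

theorem intertwines_trans2_gen1 (hκ : κ ≠ 0) (ht : IsParam κ t) :
    Intertwines κ (trans2 κ t) (dom2 κ t) (gen1 κ) (ham1 κ)
      ((1 - κ / 4 * t ^ 2) / (1 + κ / 4 * t ^ 2)) (gen1 κ) (ham1 κ)
      (κ * t / (1 + κ / 4 * t ^ 2)) genR (hamR κ) := by
  intro x hx hd
  have hD := mobiusDen_ne_zero_of_dom2 hd
  have hq : mobiusNorm κ (Complex.I * t) ≠ 0 := by rw [mobiusNorm_I_mul]; exact ht.ne'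
  have hi := isIsometryAt_mobius hx hq hD
  have hh := ham_mobius hx hq hD
  have hQ := ofReal_param_ne_zero ht
  have hq' := param_ne_zero ht
  rw [trans2_eq]
  refine ⟨_, hi, ?_, ?_⟩
  · rw [hi.fderiv_apply]
    simp only [gen1_eq, genR_eq, Prod.smul_mk, Prod.mk_add_mk, Complex.real_smul,
      smul_zero, add_zero]
    refine Prod.ext ?_ rfl
    simp only [mobiusDeriv, mobius, mobiusNorm_I_mul]
    rw [← mobiusDen]
    push_cast
    field_simp
    simp only [mobiusDen, Complex.conj_ofReal, map_mul, Complex.conj_I]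
    push_cast
    ring_nf
    simp only [Complex.I_sq]
    ring
  · rw [ham1, hh.2.1, mobiusNorm_I_mul]
    simp [ham1, hamR]
    field_simp
    ring

theorem intertwines_trans2_genR (hκ : κ ≠ 0) (ht : IsParam κ t) :
    Intertwines κ (trans2 κ t) (dom2 κ t) genR (hamR κ)
      (-t / (1 + κ / 4 * t ^ 2)) (gen1 κ) (ham1 κ)
      ((1 - κ / 4 * t ^ 2) / (1 + κ / 4 * t ^ 2)) genR (hamR κ) := by
  intro x hx hd
  have hD := mobiusDen_ne_zero_of_dom2 hd
  have hq : mobiusNorm κ (Complex.I * t) ≠ 0 := by rw [mobiusNorm_I_mul]; exact ht.ne'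
  have hi := isIsometryAt_mobius hx hq hD
  have hh := ham_mobius hx hq hD
  have hQ := ofReal_param_ne_zero ht
  rw [mul_comm] at hQ
  have hq' := param_ne_zero ht
  rw [trans2_eq]
  refine ⟨_, hi, ?_, ?_⟩
  · rw [hi.fderiv_apply]
    simp only [gen1_eq, genR_eq, Prod.smul_mk, Prod.mk_add_mk, Complex.real_smul,
      smul_zero, add_zero]
    refine Prod.ext ?_ rfl
    simp only [mobiusDeriv, mobius, mobiusNorm_I_mul]
    rw [← mobiusDen]
    push_cast
    field_simp
    simp only [mobiusDen, Complex.conj_ofReal, map_mul, Complex.conj_I]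
    push_cast
    ring_nf
    simp only [Complex.I_sq, Complex.I_pow_three]
    ring
  · rw [hamR, hh.2.2, mobiusNorm_I_mul]
    simp [ham1, hamR]
    field_simp
    ring

theorem isIsometryAt_rot (κ t : ℝ) (x : ℂ × ℝ) :
    IsIsometryAt κ (rot t) x (Complex.exp (Complex.I * t)) := by
  have hd : DifferentiableAt ℝ (rot t) x := by unfold rot; fun_prop
  refine ⟨hd, fun u => fderiv_apply_eq_of_hasDerivAt hd ?_, ?_⟩
  · refine HasDerivAt.prodMk ?_ (hasDerivAt_snd' (hasDerivAt_line x u))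
    refine ((hasDerivAt_line_fst x u).mul_const _).congr_deriv (mul_comm _ _)
  · have h1 : ‖Complex.exp (Complex.I * t)‖ = 1 := by
      rw [mul_comm]; exact Complex.norm_exp_ofReal_mul_I t
    have h2 : (Complex.exp (Complex.I * t)).re ^ 2 + (Complex.exp (Complex.I * t)).im ^ 2 = 1 := by
      have := Complex.normSq_eq_norm_sq (Complex.exp (Complex.I * t))
      rw [h1, Complex.normSq_apply] at this
      linarith
    rw [h2]
    simp [conf, rot, h1]

theorem exp_I_mul (t : ℝ) :
    Complex.exp (Complex.I * t) = (Real.cos t : ℂ) + (Real.sin t : ℂ) * Complex.I := by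
  rw [mul_comm, Complex.exp_mul_I]; push_cast; rfl

/-- On the plane spanned by S₁ and S₂ the rotation acts as an ordinary rotation of angle t up to
orientation; the next lemma gives the second row. -/
theorem intertwines_rot_gen1 (κ t : ℝ) :
    Intertwines κ (rot t) univ (gen1 κ) (ham1 κ) (Real.cos t) (gen1 κ) (ham1 κ)
      (-Real.sin t) (gen2 κ) (ham2 κ) := by
  intro x hx _
  have hi := isIsometryAt_rot κ t x
  have hc : conf κ (rot t x) = conf κ x := by
    simp only [conf, rot, norm_mul]
    rw [mul_comm Complex.I, Complex.norm_exp_ofReal_mul_I, mul_one]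
  have hcs : (Real.cos t : ℂ) ^ 2 + (Real.sin t : ℂ) ^ 2 = 1 := by
    have := Real.cos_sq_add_sin_sq t
    exact_mod_cast this
  refine ⟨_, hi, ?_, ?_⟩
  · rw [hi.fderiv_apply]
    simp only [gen1_eq, gen2_eq, Prod.smul_mk, Prod.mk_add_mk, Complex.real_smul,
      smul_zero, add_zero, rot, exp_I_mul]
    refine Prod.ext ?_ rfl
    push_cast at hcs ⊢
    linear_combination Complex.sin t ^ 2 * Complex.I_sq - hcs
  · simp only [ham1, ham2, hc]
    simp only [rot, exp_I_mul]
    simp [-Complex.ofReal_cos, -Complex.ofReal_sin]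
    ring

theorem intertwines_rot_gen2 (κ t : ℝ) :
    Intertwines κ (rot t) univ (gen2 κ) (ham2 κ) (Real.sin t) (gen1 κ) (ham1 κ)
      (Real.cos t) (gen2 κ) (ham2 κ) := by
  intro x hx _
  have hi := isIsometryAt_rot κ t x
  have hc : conf κ (rot t x) = conf κ x := by
    simp only [conf, rot, norm_mul]
    rw [mul_comm Complex.I, Complex.norm_exp_ofReal_mul_I, mul_one]
  have hcs : (Real.cos t : ℂ) ^ 2 + (Real.sin t : ℂ) ^ 2 = 1 := by
    have := Real.cos_sq_add_sin_sq t
    exact_mod_cast this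
  refine ⟨_, hi, ?_, ?_⟩
  · rw [hi.fderiv_apply]
    simp only [gen1_eq, gen2_eq, Prod.smul_mk, Prod.mk_add_mk, Complex.real_smul,
      smul_zero, add_zero, rot, exp_I_mul]
    refine Prod.ext ?_ rfl
    push_cast at hcs ⊢
    linear_combination (-Complex.I) * hcs - (Complex.I * κ * x.1 ^ 2 * Complex.sin t ^ 2 / 4
      + κ * x.1 ^ 2 * Complex.cos t * Complex.sin t / 4
      + Complex.cos t * Complex.sin t) * Complex.I_sq
  · simp only [ham1, ham2, hc]
    simp only [rot, exp_I_mul]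
    simp [-Complex.ofReal_cos, -Complex.ofReal_sin]
    ring

end Isometries

/-! ### From the manifold hypotheses to pointwise shape data -/

section Shape

local notation "E2" => EuclideanSpace ℝ (Fin 2)
local notation "e₀" => (EuclideanSpace.single (0 : Fin 2) (1 : ℝ))
local notation "e₁" => (EuclideanSpace.single (1 : Fin 2) (1 : ℝ))

variable {X : Type*} [TopologicalSpace X] [ChartedSpace (EuclideanSpace ℝ (Fin 2)) X]

/-- The differential of a map into `ℂ × ℝ`. -/
noncomputable def differential (f : X → ℂ × ℝ) (p : X) : E2 →L[ℝ] ℂ × ℝ :=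
  mfderiv (𝓡 2) 𝓘(ℝ, ℂ × ℝ) f p

theorem chris_add_left (κ : ℝ) (p u v w : ℂ × ℝ) :
    chris κ p (u + v) w = chris κ p u w + chris κ p v w := by
  refine Prod.ext (Complex.ext ?_ ?_) ?_ <;> simp [chris] <;> ring

theorem chris_smul_left (κ c : ℝ) (p u w : ℂ × ℝ) :
    chris κ p (c • u) w = c • chris κ p u w := by
  refine Prod.ext (Complex.ext ?_ ?_) ?_ <;> simp [chris] <;> ring

/-- The covariant differential of the normal. -/
noncomputable def normalDeriv (κ : ℝ) (f N : X → ℂ × ℝ) (p : X) : E2 →L[ℝ] ℂ × ℝ :=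
  LinearMap.toContinuousLinearMap
    { toFun := fun v => differential N p v + chris κ (f p) (differential f p v) (N p)
      map_add' := fun u v => by simp only [map_add, chris_add_left]; abel
      map_smul' := fun c u => by simp only [map_smul, chris_smul_left, smul_add, RingHom.id_apply] }

theorem normalDeriv_apply (κ : ℝ) (f N : X → ℂ × ℝ) (p : X) (v : E2) :
    normalDeriv κ f N p v
      = differential N p v + chris κ (f p) (differential f p v) (N p) := rfl

theorem differential_eq {f : X → ℂ × ℝ} {p : X}
    (hf : MDifferentiableAt (𝓡 2) 𝓘(ℝ, ℂ × ℝ) f p) :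
    differential f p = fderiv ℝ (inChart f p) (extChartAt (𝓡 2) p p) := by
  have h := hf.mfderiv
  rw [ModelWithCorners.range_eq_univ, fderivWithin_univ] at h
  exact h

theorem fderiv_comp_eq_differential {E : Type*} [NormedAddCommGroup E] [NormedSpace ℝ E]
    {f : X → ℂ × ℝ} {k : E → X} {z : E}
    (hf : MDifferentiableAt (𝓡 2) 𝓘(ℝ, ℂ × ℝ) f (k z))
    (hk : MDifferentiableAt 𝓘(ℝ, E) (𝓡 2) k z) (u : E) :
    fderiv ℝ (fun y => f (k y)) z u
      = differential f (k z) (mfderiv 𝓘(ℝ, E) (𝓡 2) k z u) := by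
  rw [← mfderiv_eq_fderiv]
  have := mfderiv_comp z hf hk
  exact congrArg (fun L => L u) this

variable [IsManifold (𝓡 2) ∞ X]

theorem contDiffAt_inChart {f : X → ℂ × ℝ} (hf : ContMDiff (𝓡 2) 𝓘(ℝ, ℂ × ℝ) ∞ f) (p : X)
    {y : E2} (hy : y ∈ (extChartAt (𝓡 2) p).target) : ContDiffAt ℝ ∞ (inChart f p) y := by
  have h := (contMDiffOn_extChartAt_symm (I := 𝓡 2) (n := ∞) p).contMDiffAt
    ((isOpen_extChartAt_target p).mem_nhds hy)
  exact ((hf _).comp y h).contDiffAt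

theorem metric_normal_inChart {κ : ℝ} {f N : X → ℂ × ℝ} (hf : IsOrientedImmersion κ f N) (p : X)
    {y : E2} (hy : y ∈ (extChartAt (𝓡 2) p).target) (v : E2) :
    metric κ (inChart f p y) (inChart N p y) (fderiv ℝ (inChart f p) y v) = 0 := by
  have h := ((contMDiffOn_extChartAt_symm (I := 𝓡 2) (n := ∞) p).contMDiffAt
    ((isOpen_extChartAt_target p).mem_nhds hy)).mdifferentiableAt (by simp)
  have h2 := fderiv_comp_eq_differential (f := f)
    ((hf.smooth _).mdifferentiableAt (by simp)) h v
  change metric κ _ _ (fderiv ℝ (fun y => f ((extChartAt (𝓡 2) p).symm y)) y v) = 0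
  rw [h2]
  exact hf.normal _ _

/-- Differentiating ⟨N, N⟩ = 1 and ⟨N, df⟩ = 0 in a chart identifies the covariant derivative of N
with minus the second fundamental form. Its symmetry is that of second derivatives and of `chris`;
its trace is the mean curvature equation with denominators cleared. -/
theorem isShape_of_isCMC {κ H : ℝ} {f N : X → ℂ × ℝ} (hf : IsCMC κ H f N) (p : X) :
    IsShape κ H (f p) (N p) (differential f p) (normalDeriv κ f N p) := by
  obtain ⟨hf, hH⟩ := hf
  have hp := hf.mem_space p
  set y₀ := extChartAt (𝓡 2) p p with hy₀
  have hty : (extChartAt (𝓡 2) p).target ∈ nhds y₀ := extChartAt_target_mem_nhds p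
  have hf0 : inChart f p y₀ = f p := by rw [inChart, hy₀, extChartAt_to_inv]
  have hN0 : inChart N p y₀ = N p := by rw [inChart, hy₀, extChartAt_to_inv]
  have hfs := contDiffAt_inChart hf.smooth p (mem_of_mem_nhds hty)
  have hNs := contDiffAt_inChart hf.smooth_normal p (mem_of_mem_nhds hty)
  have hf1 : ContDiffAt ℝ 1 (inChart f p) y₀ := hfs.of_le (by simp)
  have hN1 : ContDiffAt ℝ 1 (inChart N p) y₀ := hNs.of_le (by simp)
  have hA : differential f p = fderiv ℝ (inChart f p) y₀ :=
    differential_eq ((hf.smooth p).mdifferentiableAt (by simp))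
  have hB : differential N p = fderiv ℝ (inChart N p) y₀ :=
    differential_eq ((hf.smooth_normal p).mdifferentiableAt (by simp))
  have hD1 : ContDiffAt ℝ 1 (fderiv ℝ (inChart f p)) y₀ :=
    hfs.fderiv_right (m := 1) (by norm_cast)
  have hDv (v : E2) : ContDiffAt ℝ 1 (fun y => fderiv ℝ (inChart f p) y v) y₀ :=
    hD1.clm_apply contDiffAt_const
  have hunit : ∀ v, metric κ (f p) (N p) (normalDeriv κ f N p v) = 0 := by
    intro v
    have h1 : (fun y => metric κ (inChart f p y) (inChart N p y) (inChart N p y))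
        = fun _ => 1 := funext fun y => hf.unit _
    have h2 := fderiv_metric hf1 hN1 hN1 (hf0 ▸ hp) v
    rw [h1, hf0, hN0, ← hA, ← hB, ← normalDeriv_apply,
      metric_comm κ (f p) (normalDeriv κ f N p v)] at h2
    simp at h2
    linarith
  -- Weingarten's relation: the orthogonality ⟨N, ∂_v f⟩ = 0 holds on the whole chart, hence may be
  -- differentiated in the direction u.
  have hsecond : ∀ u v, metric κ (f p) (normalDeriv κ f N p u) (differential f p v)
      = -metric κ (f p) (N p) (fderiv ℝ (fun y => fderiv ℝ (inChart f p) y v) y₀ u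
        + chris κ (f p) (differential f p u) (differential f p v)) := by
    intro u v
    have h1 : (fun y => metric κ (inChart f p y) (inChart N p y) (fderiv ℝ (inChart f p) y v))
        =ᶠ[nhds y₀] fun _ => 0 :=
      Filter.mem_of_superset hty fun y hy => metric_normal_inChart hf p hy v
    have h2 := fderiv_metric hf1 hN1 (hDv v) (hf0 ▸ hp) u
    rw [h1.fderiv_eq, hf0, hN0, ← hA, ← hB, ← normalDeriv_apply] at h2
    simp at h2
    linarith
  have hsnd : ∀ u v, fderiv ℝ (fun y => fderiv ℝ (inChart f p) y v) y₀ u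
      = fderiv ℝ (fderiv ℝ (inChart f p)) y₀ u v := by
    intro u v
    rw [fderiv_clm_apply (hD1.differentiableAt one_ne_zero) (differentiableAt_const v)]
    simp
  have hsymm : IsSymmSndFDerivAt ℝ (inChart f p) y₀ := hfs.isSymmSndFDerivAt (by
    rw [minSmoothness_of_isRCLikeNormedField]; exact WithTop.coe_le_coe.2 (le_top : (2 : ℕ∞) ≤ ⊤))
  have hform (i j : Fin 2) : secondForm κ f N p i j
      = -metric κ (f p) (normalDeriv κ f N p (EuclideanSpace.single i 1))
        (differential f p (EuclideanSpace.single j 1)) := by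
    rw [hsecond, neg_neg, secondForm, christoffel_eq hp, ← metric_add_left, metric_comm, hA]
    rfl
  have hfirst (i j : Fin 2) : firstForm κ f p i j
      = metric κ (f p) (differential f p (EuclideanSpace.single i 1))
        (differential f p (EuclideanSpace.single j 1)) := by
    rw [firstForm, hA]; rfl
  have hnd := vol_ne_zero_of_injective hp (A := differential f p) (hf.injective p) (hf.unit p)
    (hf.normal p)
  refine ⟨hf.unit p, hf.normal p, hunit, fun u v => ?_, hnd, ?_⟩
  · rw [hsecond, hsecond, hsnd, hsnd, hsymm u v, chris_comm]
  · have h := hH p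
    have hg := vol_mul_vol κ (f p) (N p) (differential f p e₀) (differential f p e₁) (N p)
      (differential f p e₀) (differential f p e₁)
    have hn (v) : metric κ (f p) (N p) (differential f p v) = 0 := hf.normal p v
    rw [hf.unit, hn, hn, metric_comm κ _ (differential f p e₁) (differential f p e₀)] at hg
    have hne : metric κ (f p) (differential f p e₀) (differential f p e₀)
        * metric κ (f p) (differential f p e₁) (differential f p e₁)
        - metric κ (f p) (differential f p e₀) (differential f p e₁) ^ 2 ≠ 0 := by
      intro h0
      apply hnd
      apply mul_self_eq_zero.1
      rw [hg]
      linear_combination h0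
    rw [meanCurvature, hform, hform, hform, hfirst, hfirst, hfirst,
      div_eq_iff (mul_ne_zero two_ne_zero hne)] at h
    linear_combination h

end Shape

/-! ### Closedness of the Noether form -/

section Closed

/-- The Noether form of the momentum pair `(S, h)`, relative to the vertical potential vector, at
the point `x` and for the normal `n`. -/
noncomputable def noetherCLM (κ H : ℝ) (S : ℂ × ℝ → ℂ × ℝ) (h : ℂ × ℝ → ℝ) (x n : ℂ × ℝ) :
    (ℂ × ℝ) →L[ℝ] ℝ :=
  (conf κ x ^ 2 * (n.1.im * (S x).2 - n.2 * (S x).1.im)) •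
      Complex.reCLM.comp (ContinuousLinearMap.fst ℝ ℂ ℝ)
    + (conf κ x ^ 2 * (n.2 * (S x).1.re - n.1.re * (S x).2)) •
      Complex.imCLM.comp (ContinuousLinearMap.fst ℝ ℂ ℝ)
    + (conf κ x ^ 2 * (n.1.re * (S x).1.im - n.1.im * (S x).1.re) - 2 * H * h x) •
      ContinuousLinearMap.snd ℝ ℂ ℝ

theorem noetherCLM_apply (κ H : ℝ) (S : ℂ × ℝ → ℂ × ℝ) (h : ℂ × ℝ → ℝ) (x n u : ℂ × ℝ) :
    noetherCLM κ H S h x n u = vol κ x n (S x) u - 2 * H * (h x * u.2) := by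
  simp [noetherCLM, vol_eq]; ring

variable {E : Type*} [NormedAddCommGroup E] [NormedSpace ℝ E]

theorem contDiffAt_noetherCLM {κ : ℝ} {S : ℂ × ℝ → ℂ × ℝ} {h : ℂ × ℝ → ℝ}
    (hS : IsMomentum κ S h) (H : ℝ) {n : ℕ} {f N : E → ℂ × ℝ} {y : E}
    (hf : ContDiffAt ℝ n f y) (hN : ContDiffAt ℝ n N y) (hy : f y ∈ space κ) :
    ContDiffAt ℝ n (fun z => noetherCLM κ H S h (f z) (N z)) y := by
  have hSf : ContDiffAt ℝ n (fun z => S (f z)) y :=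
    (hS.smooth.contDiffAt.of_le (by exact_mod_cast le_top)).comp y hf
  have hhf : ContDiffAt ℝ n (fun z => h (f z)) y :=
    ((hS.smooth_ham.contDiffAt ((isOpen_space κ).mem_nhds hy)).of_le
      (by exact_mod_cast le_top)).comp y hf
  have hc := (contDiffAt_conf hf hy).pow 2
  have h1 := contDiffAt_re hSf
  have h2 := contDiffAt_im hSf
  have n1 := contDiffAt_re hN
  have n2 := contDiffAt_im hN
  exact (((hc.mul ((n2.mul hSf.snd).sub (hN.snd.mul h2))).smul contDiffAt_const).add
    ((hc.mul ((hN.snd.mul h1).sub (n1.mul hSf.snd))).smul contDiffAt_const)).add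
    (((hc.mul ((n1.mul h2).sub (n2.mul h1))).sub (contDiffAt_const.mul hhf)).smul
      contDiffAt_const)

variable {X : Type*} [TopologicalSpace X] [ChartedSpace (EuclideanSpace ℝ (Fin 2)) X]

/-- The Noether form of the momentum pair `(S, h)`, relative to the vertical potential vector. -/
noncomputable def verticalForm (κ H : ℝ) (f N : X → ℂ × ℝ) (S : ℂ × ℝ → ℂ × ℝ) (h : ℂ × ℝ → ℝ)
    (p : X) (v : TangentSpace (𝓡 2) p) : ℝ :=
  noetherCLM κ H S h (f p) (N p) (differential f p v)

/-- The pull-back of the Noether form by a map `k` from a vector space to the surface. -/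
noncomputable def pulledForm (κ H : ℝ) (f N : X → ℂ × ℝ) (S : ℂ × ℝ → ℂ × ℝ) (h : ℂ × ℝ → ℝ)
    (k : E → X) (y : E) : E →L[ℝ] ℝ :=
  (noetherCLM κ H S h (f (k y)) (N (k y))).comp (fderiv ℝ (fun z => f (k z)) y)

variable {κ H : ℝ} {f N : X → ℂ × ℝ} {S : ℂ × ℝ → ℂ × ℝ} {h : ℂ × ℝ → ℝ}

theorem pulledForm_apply (hf : ContMDiff (𝓡 2) 𝓘(ℝ, ℂ × ℝ) ∞ f) {k : E → X} {z : E}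
    (hk : MDifferentiableAt 𝓘(ℝ, E) (𝓡 2) k z) (u : E) :
    pulledForm κ H f N S h k z u
      = verticalForm κ H f N S h (k z) (mfderiv 𝓘(ℝ, E) (𝓡 2) k z u) := by
  rw [pulledForm, ContinuousLinearMap.comp_apply,
    fderiv_comp_eq_differential ((hf _).mdifferentiableAt (by simp)) hk]
  rfl

theorem contDiffAt_comp_surface {g : X → ℂ × ℝ} (hg : ContMDiff (𝓡 2) 𝓘(ℝ, ℂ × ℝ) ∞ g)
    {n : ℕ} {k : E → X} {z : E} (hk : ContMDiffAt 𝓘(ℝ, E) (𝓡 2) n k z) :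
    ContDiffAt ℝ n (fun y => g (k y)) z :=
  (((hg (k z)).of_le (by exact_mod_cast le_top)).comp z hk).contDiffAt

theorem contDiffAt_pulledForm (hS : IsMomentum κ S h) (H : ℝ) (hf : IsOrientedImmersion κ f N)
    {n : ℕ} {k : E → X} {z : E} (hk : ContMDiffAt 𝓘(ℝ, E) (𝓡 2) (n + 1 : ℕ) k z) :
    ContDiffAt ℝ n (pulledForm κ H f N S h k) z := by
  have hf2 := contDiffAt_comp_surface hf.smooth hk
  have hN2 := contDiffAt_comp_surface hf.smooth_normal hk
  have hle : ((n : ℕ) : WithTop ℕ∞) ≤ ((n + 1 : ℕ) : WithTop ℕ∞) := by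
    exact_mod_cast Nat.le_succ n
  exact (contDiffAt_noetherCLM hS H (hf2.of_le hle) (hN2.of_le hle)
    (hf.mem_space _)).clm_comp (hf2.fderiv_right (m := n) (by norm_cast))

variable [IsManifold (𝓡 2) ∞ X]

/-- The Noether form of a surface of constant mean curvature is closed. -/
theorem fderiv_pulledForm_symm (hS : IsMomentum κ S h) (hf : IsCMC κ H f N) {k : E → X} {z : E}
    (hk : ContMDiffAt 𝓘(ℝ, E) (𝓡 2) 2 k z) (u v : E) :
    fderiv ℝ (pulledForm κ H f N S h k) z u v = fderiv ℝ (pulledForm κ H f N S h k) z v u := by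
  have hsh := isShape_of_isCMC hf (k z)
  obtain ⟨hf, -⟩ := hf
  have hx := hf.mem_space (k z)
  have hk2 : ContMDiffAt 𝓘(ℝ, E) (𝓡 2) (1 + 1 : ℕ) k z := hk
  have hkd : MDifferentiableAt 𝓘(ℝ, E) (𝓡 2) k z := hk.mdifferentiableAt (by simp)
  have hf2 := contDiffAt_comp_surface hf.smooth hk2
  have hN2 := contDiffAt_comp_surface hf.smooth_normal hk2
  have hf1 : ContDiffAt ℝ 1 (fun y => f (k y)) z := hf2.of_le (by norm_num)
  have hN1 : ContDiffAt ℝ 1 (fun y => N (k y)) z := hN2.of_le (by norm_num)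
  have hD1 : ContDiffAt ℝ 1 (fderiv ℝ (fun y => f (k y))) z :=
    hf2.fderiv_right (m := 1) (by norm_num)
  have hDv (v : E) : ContDiffAt ℝ 1 (fun y => fderiv ℝ (fun y => f (k y)) y v) z :=
    hD1.clm_apply contDiffAt_const
  have hS1 : ContDiffAt ℝ 1 (fun y => S (f (k y))) z :=
    (hS.smooth.contDiffAt.of_le (by simp)).comp z hf1
  have hhd := differentiableAt_of_contDiffOn_space hS.smooth_ham hx
  have hh1 : DifferentiableAt ℝ (fun y => h (f (k y))) z :=
    hhd.comp z (hf1.differentiableAt one_ne_zero)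
  have hθ : DifferentiableAt ℝ (pulledForm κ H f N S h k) z :=
    (contDiffAt_pulledForm (n := 1) hS H hf hk2).differentiableAt (by simp)
  -- The velocities of k are recorded as vectors of the model plane. The same vectors serve for f
  -- and for N, so the shape identities apply to both derivatives.
  obtain ⟨D, hD⟩ : ∃ D : E → EuclideanSpace ℝ (Fin 2), ∀ g : X → ℂ × ℝ,
      ContMDiff (𝓡 2) 𝓘(ℝ, ℂ × ℝ) ∞ g →
      ∀ u, fderiv ℝ (fun y => g (k y)) z u = differential g (k z) (D u) :=
    ⟨fun u => mfderiv 𝓘(ℝ, E) (𝓡 2) k z u, fun g hg u =>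
      fderiv_comp_eq_differential ((hg _).mdifferentiableAt (by simp)) hkd u⟩
  have hDS (u : E) : fderiv ℝ (fun y => S (f (k y))) z u
      = fderiv ℝ S (f (k z)) (fderiv ℝ (fun y => f (k y)) z u) := by
    have := fderiv_comp z (hS.smooth.differentiable (by simp) (f (k z)))
      (hf1.differentiableAt one_ne_zero)
    exact congrArg (fun L => L u) this
  have hDh (u : E) : fderiv ℝ (fun y => h (f (k y))) z u
      = fderiv ℝ h (f (k z)) (fderiv ℝ (fun y => f (k y)) z u) := by
    have := fderiv_comp z hhd (hf1.differentiableAt one_ne_zero)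
    exact congrArg (fun L => L u) this
  have hsnd (u v : E) : fderiv ℝ (fun y => fderiv ℝ (fun y => f (k y)) y v) z u
      = fderiv ℝ (fderiv ℝ (fun y => f (k y))) z u v := by
    rw [fderiv_clm_apply (hD1.differentiableAt one_ne_zero) (differentiableAt_const v)]
    simp
  have hsymm : IsSymmSndFDerivAt ℝ (fun y => f (k y)) z := hf2.isSymmSndFDerivAt (by
    rw [minSmoothness_of_isRCLikeNormedField]; norm_num)
  have key (u v : E) : fderiv ℝ (pulledForm κ H f N S h k) z u v
      = fderiv ℝ (fun y => vol κ (f (k y)) (N (k y)) (S (f (k y)))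
          (fderiv ℝ (fun y => f (k y)) y v)) z u
        - 2 * H * (h (f (k z)) * (fderiv ℝ (fderiv ℝ (fun y => f (k y))) z u v).2
          + fderiv ℝ h (f (k z)) (fderiv ℝ (fun y => f (k y)) z u)
            * (fderiv ℝ (fun y => f (k y)) z v).2) := by
    have e : fderiv ℝ (pulledForm κ H f N S h k) z u v
        = fderiv ℝ (fun y => pulledForm κ H f N S h k y v) z u := by
      rw [fderiv_clm_apply hθ (differentiableAt_const v)]; simp
    have e1 : DifferentiableAt ℝ (fun y => vol κ (f (k y)) (N (k y)) (S (f (k y)))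
        (fderiv ℝ (fun y => f (k y)) y v)) z :=
      (contDiffAt_vol hf1 hN1 hS1 (hDv v) hx).differentiableAt one_ne_zero
    have e2 : DifferentiableAt ℝ (fun y => (fderiv ℝ (fun y => f (k y)) y v).2) z :=
      ((hDv v).differentiableAt one_ne_zero).snd
    have e3 : fderiv ℝ (fun y => (fderiv ℝ (fun y => f (k y)) y v).2) z u
        = (fderiv ℝ (fderiv ℝ (fun y => f (k y))) z u v).2 := by
      rw [← hsnd]
      have := ((ContinuousLinearMap.snd ℝ ℂ ℝ).hasFDerivAt.comp z
        ((hDv v).differentiableAt one_ne_zero).hasFDerivAt).fderiv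
      exact congrArg (fun L : E →L[ℝ] ℝ => L u) this
    rw [e]
    simp only [pulledForm, ContinuousLinearMap.comp_apply, noetherCLM_apply]
    rw [fderiv_fun_sub e1 ((hh1.fun_mul e2).const_mul _), fderiv_const_mul (hh1.fun_mul e2),
      fderiv_fun_mul hh1 e2]
    simp only [FunLike.coe_sub, Pi.sub_apply, FunLike.coe_smul, Pi.smul_apply,
      FunLike.coe_add, Pi.add_apply, smul_eq_mul, e3, hDh]
    ring
  rw [key, key, fderiv_vol hf1 hN1 hS1 (hDv v) hx, fderiv_vol hf1 hN1 hS1 (hDv u) hx, hsnd,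
    hsnd, hsymm u v, hDS, hDS, hS.nabla _ hx, hS.nabla _ hx]
  simp only [hD f hf.smooth, hD N hf.smooth_normal]
  generalize D u = a
  generalize D v = b
  have h1 := hsh.vol_normal (S (f (k z))) a b
  rw [normalDeriv_apply, normalDeriv_apply] at h1
  have h2 := hsh.vol_turn_tangent a b
  have h3 := hS.isPotential_aux hx (differential f (k z) a) (differential f (k z) b)
  have hsm (c : ℝ) (x y w : ℂ × ℝ) : vol κ (f (k z)) x (c • y) w = c * vol κ (f (k z)) x y w := by
    simp [vol_eq]; ring
  rw [hsm, hsm, chris_comm κ _ (differential f (k z) b) (differential f (k z) a)]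
  -- Second derivatives of f cancel by symmetry. The derivative of N contributes `h1`, that of S
  -- contributes `h2`, and the potential contributes `h3`, which compensates the mean curvature term
  -- of `h1`.
  linear_combination h1 + κ * h (f (k z)) * h2 - 2 * H * h3

end Closed

/-! ### Primitives of Noether forms when a Killing field is tangent -/

section Tangent

local notation "E2" => EuclideanSpace ℝ (Fin 2)

variable {X : Type*} [TopologicalSpace X] [ChartedSpace (EuclideanSpace ℝ (Fin 2)) X]
  {κ H c : ℝ} {f N : X → ℂ × ℝ} {S T U : ℂ × ℝ → ℂ × ℝ} {hS hT hU : ℂ × ℝ → ℝ}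

theorem contMDiff_comp_of_space (hf : IsOrientedImmersion κ f N) {G : ℂ × ℝ → ℝ}
    (hG : ContDiffOn ℝ ∞ G (space κ)) : ContMDiff (𝓡 2) 𝓘(ℝ, ℝ) ∞ (fun p => G (f p)) :=
  fun p => (hG.contDiffAt ((isOpen_space κ).mem_nhds (hf.mem_space p))).contMDiffAt.comp p
    (hf.smooth p)

theorem contMDiff_vol_fields (hf : IsOrientedImmersion κ f N) (hSm : ContDiff ℝ ∞ S)
    (hTm : ContDiff ℝ ∞ T) :
    ContMDiff (𝓡 2) 𝓘(ℝ, ℝ) ∞ (fun p => vol κ (f p) (N p) (S (f p)) (T (f p))) := by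
  intro p
  have h : ContDiffAt ℝ ∞ (fun z : (ℂ × ℝ) × (ℂ × ℝ) => vol κ z.1 z.2 (S z.1) (T z.1))
      (f p, N p) :=
    contDiffAt_vol contDiffAt_fst contDiffAt_snd (hSm.contDiffAt.comp _ contDiffAt_fst)
      (hTm.contDiffAt.comp _ contDiffAt_fst) (hf.mem_space p)
  exact h.contMDiffAt.comp p ((hf.smooth p).prodMk_space (hf.smooth_normal p))

/-- The differential of a real function. -/
noncomputable def scalarDiff (g : X → ℝ) (p : X) : E2 →L[ℝ] ℝ := mfderiv (𝓡 2) 𝓘(ℝ, ℝ) g p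

theorem mfderiv_eq_scalarDiff (g : X → ℝ) (p : X) (v : TangentSpace (𝓡 2) p) :
    mfderiv (𝓡 2) 𝓘(ℝ, ℝ) g p v = scalarDiff g p v := rfl

theorem scalarDiff_eq {g : X → ℝ} {p : X} (hg : MDifferentiableAt (𝓡 2) 𝓘(ℝ, ℝ) g p) :
    scalarDiff g p
      = fderiv ℝ (fun y => g ((extChartAt (𝓡 2) p).symm y)) (extChartAt (𝓡 2) p p) := by
  have h := hg.mfderiv
  rw [ModelWithCorners.range_eq_univ, fderivWithin_univ] at h
  exact h

theorem isExact_linear_comb {θ η : (p : X) → TangentSpace (𝓡 2) p → ℝ} (hθ : IsExact θ)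
    (hη : IsExact η) (a b : ℝ) : IsExact fun p v => a * θ p v + b * η p v := by
  obtain ⟨g, hg, hgd⟩ := hθ
  obtain ⟨k, hk, hkd⟩ := hη
  have hm : ContDiff ℝ ∞ fun z : ℝ × ℝ => a * z.1 + b * z.2 := by fun_prop
  refine ⟨fun p => a * g p + b * k p, hm.contMDiff.comp (hg.prodMk_space hk), fun p v => ?_⟩
  have h1 := ((hg p).mdifferentiableAt (by simp)).hasMFDerivAt
  have h2 := ((hk p).mdifferentiableAt (by simp)).hasMFDerivAt
  have h3 := ((h1.const_smul a).add (h2.const_smul b)).mfderiv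
  change a * θ p v + b * η p v = _
  rw [hgd, hkd]
  exact (congrArg (fun L : E2 →L[ℝ] ℝ => L v) h3).symm

variable [IsManifold (𝓡 2) ∞ X]

/-- Along a surface of constant mean curvature that is tangent to the Killing field `S`, the
differential of `vol (N, T, S)` is the Noether form of the bracket of `S` and `T`. -/
theorem fderiv_vol_fields (hf : IsCMC κ H f N) (hS' : IsMomentum κ S hS)
    (hT' : IsMomentum κ T hT) (hb : IsBracket κ c S T U hS hT hU)
    (ht : ∀ p, metric κ (f p) (N p) (S (f p)) = 0) (p : X) (v : E2) :
    fderiv ℝ (fun y => vol κ (inChart f p y) (inChart N p y) (T (inChart f p y))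
        (S (inChart f p y))) (extChartAt (𝓡 2) p p) v
      = c * noetherCLM κ H U hU (f p) (N p) (differential f p v) := by
  have hsh := isShape_of_isCMC hf p
  obtain ⟨hf, -⟩ := hf
  have hp := hf.mem_space p
  set y₀ := extChartAt (𝓡 2) p p with hy₀
  have hf0 : inChart f p y₀ = f p := by rw [inChart, hy₀, extChartAt_to_inv]
  have hN0 : inChart N p y₀ = N p := by rw [inChart, hy₀, extChartAt_to_inv]
  have hy := mem_extChartAt_target (I := 𝓡 2) p
  have hf1 : ContDiffAt ℝ 1 (inChart f p) y₀ := (contDiffAt_inChart hf.smooth p hy).of_le (by simp)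
  have hN1 : ContDiffAt ℝ 1 (inChart N p) y₀ :=
    (contDiffAt_inChart hf.smooth_normal p hy).of_le (by simp)
  have hA : fderiv ℝ (inChart f p) y₀ = differential f p :=
    (differential_eq ((hf.smooth p).mdifferentiableAt (by simp))).symm
  have hB : fderiv ℝ (inChart N p) y₀ = differential N p :=
    (differential_eq ((hf.smooth_normal p).mdifferentiableAt (by simp))).symm
  have hcomp {V : ℂ × ℝ → ℂ × ℝ} (hV : ContDiff ℝ ∞ V) :
      ContDiffAt ℝ 1 (fun y => V (inChart f p y)) y₀ :=
    (hV.contDiffAt.of_le (by simp)).comp y₀ hf1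
  have hDV {V : ℂ × ℝ → ℂ × ℝ} {hV : ℂ × ℝ → ℝ} (hm : IsMomentum κ V hV) (u : E2) :
      fderiv ℝ (fun y => V (inChart f p y)) y₀ u + chris κ (f p) (differential f p u) (V (f p))
        = (κ * hV (f p)) • turn (differential f p u) := by
    have e := fderiv_comp y₀ (hm.smooth.differentiable (by simp) (inChart f p y₀))
      (hf1.differentiableAt one_ne_zero)
    rw [hf0, hA] at e
    have e' : fderiv ℝ (fun y => V (inChart f p y)) y₀ u
        = fderiv ℝ V (f p) (differential f p u) := congrArg (fun L => L u) e
    rw [e', hm.nabla _ hp]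
  have hp' : inChart f p y₀ ∈ space κ := hf0 ▸ hp
  rw [fderiv_vol hf1 hN1 (hcomp hT'.smooth) (hcomp hS'.smooth) hp', hA, hB, hf0, hN0, hDV hT',
    hDV hS', ← normalDeriv_apply]
  -- Differentiate the tangency ⟨N, S⟩ = 0, then move the quarter turn to N by skewness.
  have hnormal (u : E2) : metric κ (f p) (normalDeriv κ f N p u) (S (f p))
      = metric κ (f p) (differential f p u) ((κ * hS (f p)) • turn (N p)) := by
    have e := fderiv_metric hf1 hN1 (hcomp hS'.smooth) hp' u
    have e0 : (fun y => metric κ (inChart f p y) (inChart N p y) (S (inChart f p y)))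
        = fun _ => 0 := funext fun y => ht _
    rw [e0, hA, hB, hf0, hN0, hDV hS', ← normalDeriv_apply, metric_smul_right] at e
    simp at e
    rw [metric_smul_right]
    have := metric_turn κ (f p) (N p) (differential f p u)
    rw [metric_comm κ (f p) (turn (N p))] at this
    linear_combination -κ * hS (f p) * this - e
  obtain ⟨w, hw⟩ := hsh.exists_tangent hp (ht p)
  have hturn : metric κ (f p) (N p) (turn (N p)) = 0 := by
    have := metric_turn κ (f p) (N p) (N p)
    rw [metric_comm κ (f p) (turn (N p))] at this
    linarith
  have h1 := hsh.vol_normal (T (f p)) v w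
  have h2 := hsh.vol_turn_tangent v w
  -- With S = df(w), symmetry of the shape operator turns `hnormal` into a formula for the
  -- tangential part of ∇_w N. Both vectors are orthogonal to N, so ∇_w N and κ h_S J N have the
  -- same volumes.
  have h3 := hsh.vol_congr (x := normalDeriv κ f N p w) (y := (κ * hS (f p)) • turn (N p))
    (by rw [hsh.normal_deriv, metric_smul_right, hturn, mul_zero])
    (fun u => by rw [← hnormal, metric_comm, ← hw, hsh.symm])
    (T (f p)) (differential f p v)
  have h4 := vol_turn κ (f p) (N p) (T (f p)) (differential f p v)
  have h5 := hb.ham _ hp (differential f p v)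
  have h6 := congrArg (fun z => vol κ (f p) (N p) z (differential f p v)) (hb.field _ hp)
  rw [hw] at h1 h2
  have hs1 (a : ℝ) (x y w : ℂ × ℝ) : vol κ (f p) (a • y) x w = a * vol κ (f p) y x w := by
    simp [vol_eq]; ring
  have hs2 (a : ℝ) (x y w : ℂ × ℝ) : vol κ (f p) x (a • y) w = a * vol κ (f p) x y w := by
    simp [vol_eq]; ring
  have hs3 (a : ℝ) (x y w : ℂ × ℝ) : vol κ (f p) x w (a • y) = a * vol κ (f p) x w y := by
    simp [vol_eq]; ring
  have hs4 (x y z w : ℂ × ℝ) : vol κ (f p) x (y - z) w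
      = vol κ (f p) x y w - vol κ (f p) x z w := by
    simp [vol_eq]; ring
  have hs5 (x y z : ℂ × ℝ) : vol κ (f p) x y z = -vol κ (f p) x z y := by
    simp only [vol_eq]; ring
  simp only [hs1, hs2, hs3, hs4] at h3 h6 ⊢
  rw [noetherCLM_apply]
  rw [hs5 (T (f p)) (differential f p v)] at h1
  -- The term in ∇_v N is exchanged for one in ∇_w N plus a mean curvature term. Skewness of J then
  -- gathers the rest into vol(N, [S, T], df v), and `h5` rewrites the mean curvature term with the
  -- hamiltonian of U.
  linear_combination h1 + h3 + κ * hT (f p) * h2 + κ * hS (f p) * h4 + h6 - 2 * H * h5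

/-- The Noether form of the bracket of `S` and `T` is exact on a surface of constant mean
curvature tangent to `S`. -/
theorem isExact_verticalForm_of_tangent (hf : IsCMC κ H f N) (hS' : IsMomentum κ S hS)
    (hT' : IsMomentum κ T hT) (hc : c ≠ 0) (hb : IsBracket κ c S T U hS hT hU)
    (ht : ∀ p, metric κ (f p) (N p) (S (f p)) = 0) : IsExact (verticalForm κ H f N U hU) := by
  have hs := contMDiff_vol_fields hf.1 hT'.smooth hS'.smooth
  have h0 : IsExact fun p v => c * verticalForm κ H f N U hU p v := by
    refine ⟨_, hs, fun p v => ?_⟩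
    rw [mfderiv_eq_scalarDiff, scalarDiff_eq ((hs p).mdifferentiableAt (by simp))]
    exact (fderiv_vol_fields hf hS' hT' hb ht p v).symm
  -- Division by c, written as a linear combination whose second coefficient is zero.
  have h1 := isExact_linear_comb h0 h0 c⁻¹ 0
  simpa [hc] using h1

end Tangent

/-! ### Integration along smooth singular chains -/

section Integration

local notation "E2" => EuclideanSpace ℝ (Fin 2)

variable {X : Type*} [TopologicalSpace X] [ChartedSpace (EuclideanSpace ℝ (Fin 2)) X]

/-- The value of the form `θ` on the velocity of the curve `g`. -/
noncomputable def alongCurve (θ : (p : X) → TangentSpace (𝓡 2) p → ℝ) (g : ℝ → X) (t : ℝ) : ℝ :=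
  θ (g t) (mfderiv 𝓘(ℝ, ℝ) (𝓡 2) g t (1 : ℝ))

/-- The integral of the form `θ` along a `1`-simplex. -/
noncomputable def simplexIntegral (θ : (p : X) → TangentSpace (𝓡 2) p → ℝ) (γ : Simplex1 X) : ℝ :=
  ∫ t in (0 : ℝ)..1, alongCurve θ (IccExtend zero_le_one γ.1) t

theorem integral_eq_sum (θ : (p : X) → TangentSpace (𝓡 2) p → ℝ) (c : Simplex1 X →₀ ℤ) :
    integral θ c = c.sum fun γ n => (n : ℝ) * simplexIntegral θ γ := rfl

theorem form_congr (θ : (p : X) → TangentSpace (𝓡 2) p → ℝ) {p q : X} (h : p = q) (v : E2) :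
    θ p v = θ q v := by
  subst h; rfl

theorem alongCurve_congr (θ : (p : X) → TangentSpace (𝓡 2) p → ℝ) {g k : ℝ → X} {t : ℝ}
    (h : g =ᶠ[nhds t] k) : alongCurve θ g t = alongCurve θ k t := by
  have h1 : (mfderiv 𝓘(ℝ, ℝ) (𝓡 2) g t (1 : ℝ) : E2) = mfderiv 𝓘(ℝ, ℝ) (𝓡 2) k t (1 : ℝ) :=
    congrArg (fun L : ℝ →L[ℝ] E2 => L 1) h.mfderiv_eq
  exact (congrArg (fun v : E2 => θ (g t) v) h1).trans (form_congr θ h.self_of_nhds _)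

/-- `g` is a smooth extension of the simplex `γ`. -/
def Extends (g : ℝ → X) (γ : Simplex1 X) : Prop :=
  (∀ t ∈ Icc (0 : ℝ) 1, ContMDiffAt 𝓘(ℝ, ℝ) (𝓡 2) ∞ g t) ∧ ∀ t, γ.1 t = g t

theorem alongCurve_iccExtend (θ : (p : X) → TangentSpace (𝓡 2) p → ℝ) {g : ℝ → X}
    {γ : Simplex1 X} (hg : Extends g γ) :
    EqOn (alongCurve θ (IccExtend zero_le_one γ.1)) (alongCurve θ g) (Ioo 0 1) := by
  intro t ht
  apply alongCurve_congr
  filter_upwards [Icc_mem_nhds ht.1 ht.2] with s hs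
  rw [IccExtend_of_mem zero_le_one γ.1 hs]
  exact hg.2 ⟨s, hs⟩

/-- The constant extension of a simplex may fail to be differentiable at 0 and 1. It agrees with a
smooth extension near every interior point, and the endpoints do not affect the integral. -/
theorem simplexIntegral_eq (θ : (p : X) → TangentSpace (𝓡 2) p → ℝ) {g : ℝ → X}
    {γ : Simplex1 X} (hg : Extends g γ) :
    simplexIntegral θ γ = ∫ t in (0 : ℝ)..1, alongCurve θ g t :=
  intervalIntegral.integral_congr_Ioo_of_le zero_le_one (alongCurve_iccExtend θ hg)

/-- A form is integrable along all smooth simplices. -/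
def IsSimplexIntegrable (θ : (p : X) → TangentSpace (𝓡 2) p → ℝ) : Prop :=
  ∀ (g : ℝ → X), (∀ t ∈ Icc (0 : ℝ) 1, ContMDiffAt 𝓘(ℝ, ℝ) (𝓡 2) ∞ g t) →
    IntervalIntegrable (alongCurve θ g) MeasureTheory.volume 0 1

/-- The fundamental theorem of calculus along a `1`-simplex. -/
theorem integral_alongCurve_eq_sub {θ : (p : X) → TangentSpace (𝓡 2) p → ℝ} {g : ℝ → X}
    {P : ℝ → ℝ} (hP : ∀ t ∈ Icc (0 : ℝ) 1, ContDiffAt ℝ 1 P t)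
    (hd : ∀ t ∈ Icc (0 : ℝ) 1, alongCurve θ g t = deriv P t) :
    IntervalIntegrable (alongCurve θ g) MeasureTheory.volume 0 1 ∧
      ∫ t in (0 : ℝ)..1, alongCurve θ g t = P 1 - P 0 := by
  have hc : ContinuousOn (deriv P) (uIcc 0 1) := by
    rw [uIcc_of_le zero_le_one]
    intro t ht
    have h1 : ContinuousAt (fderiv ℝ P) t :=
      ((hP t ht).fderiv_right (m := 0) (by simp)).continuousAt
    exact (h1.clm_apply continuousAt_const).continuousWithinAt
  have hi : IntervalIntegrable (deriv P) MeasureTheory.volume 0 1 := hc.intervalIntegrable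
  have he : EqOn (deriv P) (alongCurve θ g) (uIoo 0 1) := by
    rw [uIoo_of_le zero_le_one]
    exact fun t ht => (hd t (Ioo_subset_Icc_self ht)).symm
  refine ⟨hi.congr_uIoo he, ?_⟩
  rw [← intervalIntegral.integral_congr_uIoo he]
  refine intervalIntegral.integral_eq_sub_of_hasDerivAt (fun t ht => ?_) hi
  rw [uIcc_of_le zero_le_one] at ht
  exact ((hP t ht).differentiableAt one_ne_zero).hasDerivAt

theorem exists_primitive_of_isExact {θ : (p : X) → TangentSpace (𝓡 2) p → ℝ} {h : X → ℝ}
    (hs : ContMDiff (𝓡 2) 𝓘(ℝ, ℝ) ∞ h)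
    (hd : ∀ p, ∀ v : TangentSpace (𝓡 2) p, θ p v = mfderiv (𝓡 2) 𝓘(ℝ, ℝ) h p v)
    {g : ℝ → X} (hg : ∀ t ∈ Icc (0 : ℝ) 1, ContMDiffAt 𝓘(ℝ, ℝ) (𝓡 2) ∞ g t) :
    IntervalIntegrable (alongCurve θ g) MeasureTheory.volume 0 1 ∧
      ∫ t in (0 : ℝ)..1, alongCurve θ g t = h (g 1) - h (g 0) := by
  refine integral_alongCurve_eq_sub (P := fun t => h (g t)) (fun t ht => ?_) (fun t ht => ?_)
  · exact (((hs (g t)).comp t (hg t ht)).contDiffAt).of_le (by simp)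
  · have h1 := mfderiv_comp t ((hs (g t)).mdifferentiableAt (by simp))
      ((hg t ht).mdifferentiableAt (by simp))
    rw [alongCurve, hd]
    have h2 := congrArg (fun L : ℝ →L[ℝ] ℝ => L 1) h1
    have h3 : deriv (fun t => h (g t)) t = mfderiv 𝓘(ℝ, ℝ) 𝓘(ℝ, ℝ) (h ∘ g) t (1 : ℝ) := by
      rw [mfderiv_eq_fderiv]; rfl
    rw [h3]
    exact h2.symm

theorem isSimplexIntegrable_of_isExact {θ : (p : X) → TangentSpace (𝓡 2) p → ℝ} (hθ : IsExact θ) :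
    IsSimplexIntegrable θ := by
  obtain ⟨h, hs, hd⟩ := hθ
  exact fun g hg => (exists_primitive_of_isExact hs hd hg).1

/-- The integral as a homomorphism. -/
noncomputable def integralHom (θ : (p : X) → TangentSpace (𝓡 2) p → ℝ) :
    (Simplex1 X →₀ ℤ) →+ ℝ :=
  Finsupp.liftAddHom fun γ =>
    (AddMonoidHom.mulRight (simplexIntegral θ γ)).comp (Int.castAddHom ℝ)

theorem integral_eq_integralHom (θ : (p : X) → TangentSpace (𝓡 2) p → ℝ)
    (c : Simplex1 X →₀ ℤ) : integral θ c = integralHom θ c := rfl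

theorem integralHom_single (θ : (p : X) → TangentSpace (𝓡 2) p → ℝ) (γ : Simplex1 X) (n : ℤ) :
    integralHom θ (Finsupp.single γ n) = n * simplexIntegral θ γ := by
  rw [integralHom, Finsupp.liftAddHom_apply_single]; rfl

/-- An exact form has no periods. -/
theorem integral_eq_zero_of_isExact {θ : (p : X) → TangentSpace (𝓡 2) p → ℝ} (hθ : IsExact θ)
    {c : Simplex1 X →₀ ℤ} (hc : IsCycle c) : integral θ c = 0 := by
  obtain ⟨h, hs, hd⟩ := hθ
  have hγ (γ : Simplex1 X) : simplexIntegral θ γ = h (γ.1 1) - h (γ.1 0) := by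
    obtain ⟨g, hg⟩ := γ.2
    rw [simplexIntegral_eq θ (g := g) hg, (exists_primitive_of_isExact hs hd hg.1).2, hg.2, hg.2]
    rfl
  let ev : (X →₀ ℤ) →+ ℝ := Finsupp.liftAddHom fun p =>
    (AddMonoidHom.mulRight (h p)).comp (Int.castAddHom ℝ)
  have hev (p : X) (n : ℤ) : ev (Finsupp.single p n) = n * h p := by
    rw [Finsupp.liftAddHom_apply_single]; rfl
  have key : integral θ c = ev (boundary1 c) := by
    rw [integral_eq_sum, boundary1, Finsupp.sum, Finsupp.sum, map_sum]
    refine Finset.sum_congr rfl fun γ _ => ?_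
    rw [map_sub, hev, hev, hγ]; ring
  rw [key, hc, map_zero]

/-- Forms with vanishing integral along the boundaries of `2`-simplices have the same integral
along homologous chains. -/
theorem integral_eq_of_homologous {θ : (p : X) → TangentSpace (𝓡 2) p → ℝ}
    (hθ : ∀ s : Simplex2 X, simplexIntegral θ s.face0 - simplexIntegral θ s.face1
      + simplexIntegral θ s.face2 = 0)
    {c c' : Simplex1 X →₀ ℤ} (h : Homologous c c') : integral θ c' = integral θ c := by
  obtain ⟨b, hb⟩ := h
  rw [integral_eq_integralHom, integral_eq_integralHom, ← sub_eq_zero, ← map_sub, hb, boundary2,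
    Finsupp.sum, map_sum]
  refine Finset.sum_eq_zero fun s _ => ?_
  rw [map_add, map_sub, integralHom_single, integralHom_single, integralHom_single]
  linear_combination (b s : ℝ) * hθ s

theorem Extends.map {g : ℝ → X} {γ : Simplex1 X} (hg : Extends g γ) (φ : X ≃ₘ^∞⟮𝓡 2, 𝓡 2⟯ X) :
    Extends (fun t => φ (g t)) (Simplex1.map φ γ) :=
  ⟨fun t ht => (φ.contMDiff (g t)).comp t (hg.1 t ht), fun t => congrArg φ (hg.2 t)⟩

/-- The pull-back of a form by a diffeomorphism. -/
noncomputable def pullback (φ : X ≃ₘ^∞⟮𝓡 2, 𝓡 2⟯ X) (θ : (p : X) → TangentSpace (𝓡 2) p → ℝ)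
    (p : X) (v : TangentSpace (𝓡 2) p) : ℝ :=
  θ (φ p) (mfderiv (𝓡 2) (𝓡 2) φ p v)

/-- Change of variables: by the chain rule the two integrands agree on the open interval. -/
theorem integral_pushforward (φ : X ≃ₘ^∞⟮𝓡 2, 𝓡 2⟯ X)
    (θ : (p : X) → TangentSpace (𝓡 2) p → ℝ) (c : Simplex1 X →₀ ℤ) :
    integral θ (pushforward φ c) = integral (pullback φ θ) c := by
  have hγ (γ : Simplex1 X) :
      simplexIntegral θ (Simplex1.map φ γ) = simplexIntegral (pullback φ θ) γ := by
    obtain ⟨g, hg⟩ := γ.2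
    have hg : Extends g γ := hg
    rw [simplexIntegral_eq θ (hg.map φ), simplexIntegral_eq _ hg]
    refine intervalIntegral.integral_congr_Ioo_of_le zero_le_one fun t ht => ?_
    have h1 := mfderiv_comp t ((φ.contMDiff (g t)).mdifferentiableAt (by simp))
      ((hg.1 t (Ioo_subset_Icc_self ht)).mdifferentiableAt (by simp))
    exact congrArg (fun L : ℝ →L[ℝ] E2 => θ (φ (g t)) (L 1)) h1
  rw [integral_eq_sum, integral_eq_sum, pushforward, Finsupp.sum_mapDomain_index]
  · simp only [hγ]
  · simp
  · intros; push_cast; ring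

theorem integral_linear_comb {θ η : (p : X) → TangentSpace (𝓡 2) p → ℝ}
    (hθ : IsSimplexIntegrable θ) (hη : IsSimplexIntegrable η) (a b : ℝ) (c : Simplex1 X →₀ ℤ) :
    integral (fun p v => a * θ p v + b * η p v) c = a * integral θ c + b * integral η c := by
  have hγ (γ : Simplex1 X) : simplexIntegral (fun p v => a * θ p v + b * η p v) γ
      = a * simplexIntegral θ γ + b * simplexIntegral η γ := by
    obtain ⟨g, hg⟩ := γ.2
    have hg : Extends g γ := hg
    rw [simplexIntegral_eq _ hg, simplexIntegral_eq _ hg, simplexIntegral_eq _ hg,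
      ← intervalIntegral.integral_const_mul, ← intervalIntegral.integral_const_mul,
      ← intervalIntegral.integral_add ((hθ g hg.1).const_mul a) ((hη g hg.1).const_mul b)]
    rfl
  simp only [integral_eq_sum, hγ, Finsupp.sum, Finset.mul_sum, ← Finset.sum_add_distrib]
  exact Finset.sum_congr rfl fun γ _ => by ring

end Integration

/-! ### Stokes' theorem on singular triangles -/

section Stokes

variable {X : Type*} [TopologicalSpace X] [ChartedSpace (EuclideanSpace ℝ (Fin 2)) X]
  {κ H : ℝ} {f N : X → ℂ × ℝ} {S : ℂ × ℝ → ℂ × ℝ} {h : ℂ × ℝ → ℝ}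

theorem isSimplexIntegrable_verticalForm (hS : IsMomentum κ S h) (H : ℝ)
    (hf : IsOrientedImmersion κ f N) : IsSimplexIntegrable (verticalForm κ H f N S h) := by
  intro g hg
  have he : ∀ t ∈ Icc (0 : ℝ) 1, pulledForm κ H f N S h g t 1
      = alongCurve (verticalForm κ H f N S h) g t := fun t ht =>
    pulledForm_apply hf.smooth ((hg t ht).mdifferentiableAt (by simp)) 1
  have hc : ContinuousOn (fun t => pulledForm κ H f N S h g t 1) (uIcc (0 : ℝ) 1) := by
    rw [uIcc_of_le zero_le_one]
    intro t ht
    have h1 : ContDiffAt ℝ (0 : ℕ) (pulledForm κ H f N S h g) t :=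
      contDiffAt_pulledForm hS H hf ((hg t ht).of_le (by simp))
    exact (h1.continuousAt.clm_apply continuousAt_const).continuousWithinAt
  refine hc.intervalIntegrable.congr_uIoo fun t ht => he t ?_
  rw [uIoo_of_le zero_le_one] at ht
  exact Ioo_subset_Icc_self ht

theorem isCompact_triangle : IsCompact triangle := by
  refine (isCompact_Icc (a := ((0, 0) : ℝ × ℝ)) (b := (1, 1))).of_isClosed_subset ?_ ?_
  · exact (isClosed_le continuous_const continuous_fst).inter
      ((isClosed_le continuous_const continuous_snd).inter
        (isClosed_le (continuous_fst.add continuous_snd) continuous_const))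
  · rintro ⟨a, b⟩ ⟨h1, h2, h3⟩
    simp only at h1 h2 h3
    exact ⟨⟨h1, h2⟩, ⟨by simp only; linarith, by simp only; linarith⟩⟩

theorem convex_triangle : Convex ℝ triangle := by
  rintro ⟨a, b⟩ ⟨h1, h2, h3⟩ ⟨c, d⟩ ⟨h4, h5, h6⟩ x y hx hy hxy
  simp only at h1 h2 h3 h4 h5 h6
  refine ⟨?_, ?_, ?_⟩ <;> simp only [Prod.smul_mk, Prod.mk_add_mk, smul_eq_mul]
  · positivity
  · positivity
  · nlinarith

variable [IsManifold (𝓡 2) ∞ X]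

/-- Stokes' theorem for the Noether form on a `2`-simplex. -/
theorem integral_verticalForm_boundary (hS : IsMomentum κ S h) (hf : IsCMC κ H f N)
    (s : Simplex2 X) :
    simplexIntegral (verticalForm κ H f N S h) s.face0
      - simplexIntegral (verticalForm κ H f N S h) s.face1
      + simplexIntegral (verticalForm κ H f N S h) s.face2 = 0 := by
  obtain ⟨g, hg, hsg⟩ := s.2
  have : IsManifold (𝓡 2) 2 X := IsManifold.of_le (n := ∞)
    (WithTop.coe_le_coe.2 (le_top : (2 : ℕ∞) ≤ ⊤))
  -- Class C² at a point is an open condition, unlike C^∞ at a point, whose neighbourhoods may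
  -- shrink with the order. Two derivatives suffice for closedness.
  have hopen : IsOpen {q | ContMDiffAt 𝓘(ℝ, ℝ × ℝ) (𝓡 2) 2 g q} := by
    rw [isOpen_iff_mem_nhds]
    exact fun q hq => (contMDiffAt_iff_contMDiffAt_nhds (by simp)).1 hq
  have hsub : triangle ⊆ {q | ContMDiffAt 𝓘(ℝ, ℝ × ℝ) (𝓡 2) 2 g q} := fun q hq =>
    (hg q hq).of_le (WithTop.coe_le_coe.2 (le_top : (2 : ℕ∞) ≤ ⊤))
  -- By compactness a thickening of the triangle lies in the C² region. It is open and, like the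
  -- triangle, convex, so the closed pulled-back form has a primitive P there.
  obtain ⟨δ, hδ, hW⟩ := isCompact_triangle.exists_thickening_subset_open hopen hsub
  set W := Metric.thickening δ triangle
  have hWo : IsOpen W := Metric.isOpen_thickening
  have hWt : triangle ⊆ W := Metric.self_subset_thickening hδ _
  have hcd : ∀ q ∈ W, ContDiffAt ℝ 1 (pulledForm κ H f N S h g) q := fun q hq =>
    contDiffAt_pulledForm (n := 1) hS H hf.1 (hW hq)
  obtain ⟨P, hP⟩ := (convex_triangle.thickening δ).exists_forall_hasFDerivAt_of_fderiv_symmetric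
    hWo (fun q hq => ((hcd q hq).differentiableAt one_ne_zero).differentiableWithinAt)
    (fun q hq u v => fderiv_pulledForm_symm hS hf (hW hq) u v)
  have hP1 : ∀ q ∈ W, ContDiffAt ℝ 1 P q := by
    have : ContDiffOn ℝ (0 + 1) P W := by
      rw [contDiffOn_succ_iff_fderiv_of_isOpen hWo]
      refine ⟨fun q hq => (hP q hq).differentiableAt.differentiableWithinAt, by simp, ?_⟩
      rw [contDiffOn_zero]
      have hcont : ContinuousOn (pulledForm κ H f N S h g) W :=
        fun q hq => (hcd q hq).continuousAt.continuousWithinAt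
      exact hcont.congr fun q hq => (hP q hq).fderiv
    rw [zero_add] at this
    exact fun q hq => this.contDiffAt (hWo.mem_nhds hq)
  have face (a : ℝ → ℝ × ℝ) (ha : ContDiff ℝ ∞ a) (hm : ∀ t ∈ Icc (0 : ℝ) 1, a t ∈ triangle) :
      simplexIntegral (verticalForm κ H f N S h) (s.comp a ha hm) = P (a 1) - P (a 0) := by
    have hext : Extends (g ∘ a) (s.comp a ha hm) :=
      ⟨fun t ht => (hg (a t) (hm t ht)).comp t ha.contMDiff.contMDiffAt, fun t => hsg _⟩
    rw [simplexIntegral_eq _ hext]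
    refine (integral_alongCurve_eq_sub (P := fun t => P (a t)) (fun t ht => ?_)
      (fun t ht => ?_)).2
    · exact (hP1 _ (hWt (hm t ht))).comp t (ha.contDiffAt.of_le (by simp))
    · have hda : HasDerivAt a (deriv a t) t := (ha.differentiable (by simp) t).hasDerivAt
      have hgd := (hg (a t) (hm t ht)).mdifferentiableAt (by simp)
      have h1 : deriv (fun t => P (a t)) t = pulledForm κ H f N S h g (a t) (deriv a t) :=
        ((hP _ (hWt (hm t ht))).comp_hasDerivAt t hda).deriv
      have h2 := mfderiv_comp t hgd (ha.contMDiff.mdifferentiable (by simp) t)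
      have h3 : (mfderiv 𝓘(ℝ, ℝ) 𝓘(ℝ, ℝ × ℝ) a t : ℝ →L[ℝ] ℝ × ℝ) 1 = deriv a t := by
        rw [mfderiv_eq_fderiv]; rfl
      rw [h1, pulledForm_apply hf.1.smooth hgd, ← h3]
      exact congrArg (fun L : ℝ →L[ℝ] EuclideanSpace ℝ (Fin 2) =>
        verticalForm κ H f N S h (g (a t)) (L 1)) h2
  have h0 : simplexIntegral (verticalForm κ H f N S h) s.face0 = _ := face _ _ _
  have h1 : simplexIntegral (verticalForm κ H f N S h) s.face1 = _ := face _ _ _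
  have h2 : simplexIntegral (verticalForm κ H f N S h) s.face2 = _ := face _ _ _
  rw [h0, h1, h2]
  -- The three differences of P at the vertices telescope.
  simp

end Stokes

/-! ### Tangency of the generator and pull-back under an isometry -/

section Invariance

local notation "E2" => EuclideanSpace ℝ (Fin 2)

/-- The parameters form a nonempty open subset of the line, of positive measure, whereas a countable
set is null. -/
theorem uncountable_param (κ : ℝ) : Uncountable {t : ℝ // IsParam κ t} := by
  rw [← not_countable_iff]
  intro h
  have hc : {t : ℝ | IsParam κ t}.Countable := Set.countable_coe_iff.1 h
  have ho : IsOpen {t : ℝ | IsParam κ t} :=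
    isOpen_lt continuous_const (by fun_prop : Continuous fun t : ℝ => 1 + κ / 4 * t ^ 2)
  exact (ho.measure_pos MeasureTheory.volume ⟨0, by simp [IsParam]⟩).ne'
    (hc.measure_zero MeasureTheory.volume)

/-- A family indexed by an uncountable type, in a second countable space, accumulates at one of
its members. -/
theorem exists_neBot_comap_nhds {α Y : Type*} [Uncountable α] [tY : TopologicalSpace Y]
    [SecondCountableTopology Y] (ψ : α → Y) :
    ∃ a, (Filter.comap ψ (nhds (ψ a)) ⊓ Filter.principal {a}ᶜ).NeBot := by
  by_contra! h
  -- If no member were an accumulation, the topology induced by ψ would be discrete as well as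
  -- second countable, forcing α to be countable.
  let _ : TopologicalSpace α := TopologicalSpace.induced ψ tY
  have : SecondCountableTopology α := TopologicalSpace.secondCountableTopology_induced α Y ψ
  have : DiscreteTopology α := discreteTopology_iff_nhds_ne.2 fun a => by
    rw [nhdsWithin, nhds_induced]
    exact h a
  exact not_countable (TopologicalSpace.separableSpace_iff_countable.1
    (inferInstance : TopologicalSpace.SeparableSpace α))

open Asymptotics Filter in
/-- If an immersed piece of surface meets a curve at parameters accumulating at a point, the
velocity of the curve there is tangent to the surface. -/
theorem apply_velocity_eq_zero_of_frequently_mem {E V α : Type*} [NormedAddCommGroup E]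
    [NormedSpace ℝ E] [FiniteDimensional ℝ E] [NormedAddCommGroup V] [NormedSpace ℝ V]
    {k : E → V} {y₀ : E} {A : E →L[ℝ] V} (hk : HasFDerivAt k A y₀)
    (hA : Function.Injective A) {γ : ℝ → V} {w : V} {t₀ : ℝ} (hγ : HasDerivAt γ w t₀)
    {l : Filter α} [l.NeBot] {y : α → E} {t : α → ℝ} (hy : Tendsto y l (nhds y₀))
    (ht : Tendsto t l (nhds t₀)) (hne : ∀ᶠ a in l, t a ≠ t₀) (h₀ : k y₀ = γ t₀)
    (h : ∀ᶠ a in l, k (y a) = γ (t a)) (L : V →L[ℝ] ℝ) (hL : ∀ v, L (A v) = 0) : L w = 0 := by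
  obtain ⟨K, -, hK⟩ := (A : E →ₗ[ℝ] V).exists_antilipschitzWith (LinearMap.ker_eq_bot.2 hA)
  -- An injective linear map on a finite-dimensional space is bounded below. This controls y - y₀ by
  -- the displacement k(y) - k(y₀), hence by t - t₀.
  have hAe : (fun a => y a - y₀) =O[l] fun a => A (y a - y₀) :=
    IsBigO.of_bound K (Eventually.of_forall fun a => by
      have := hK.le_mul_dist (y a - y₀) 0
      simpa using this)
  have h1 : (fun a => k (y a) - k y₀ - A (y a - y₀)) =o[l] fun a => y a - y₀ :=
    hk.isLittleO.comp_tendsto hy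
  have h2 : (fun a => A (y a - y₀)) =O[l] fun a => k (y a) - k y₀ := by
    simpa using (h1.trans_isBigO hAe).right_isBigO_add
  have h3 : (fun a => γ (t a) - γ t₀) =O[l] fun a => t a - t₀ :=
    hγ.hasFDerivAt.isBigO_sub.comp_tendsto ht
  have h4 : (fun a => k (y a) - k y₀) =O[l] fun a => t a - t₀ :=
    h3.congr' (h.mono fun a ha => by simp only [ha, h₀]) EventuallyEq.rfl
  -- L kills the image of A, so to first order L does not see the displacement of the curve; `h6`
  -- compares this with the first-order term (t - t₀) L w.
  have h5 : (fun a => L (γ (t a) - γ t₀)) =o[l] fun a => t a - t₀ := by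
    refine ((L.isBigO_comp _ l).trans_isLittleO
      (h1.trans_isBigO ((hAe.trans h2).trans h4))).congr' (h.mono fun a ha => ?_) EventuallyEq.rfl
    simp only [map_sub L _ (A _), hL, sub_zero, ha, h₀]
  have h6 : (fun a => L (γ (t a) - γ t₀ - (t a - t₀) • w)) =o[l] fun a => t a - t₀ :=
    (L.isBigO_comp _ l).trans_isLittleO (hγ.isLittleO.comp_tendsto ht)
  have h7 : (fun a => (t a - t₀) * L w) =o[l] fun a => t a - t₀ :=
    (h5.sub h6).congr_left fun a => by simp
  have h8 : Tendsto (fun _ : α => L w) l (nhds 0) :=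
    h7.tendsto_div_nhds_zero.congr' (hne.mono fun a ha => by
      rw [mul_div_cancel_left₀ _ (sub_ne_zero.2 ha)])
  exact tendsto_nhds_unique tendsto_const_nhds h8

/-- The metric, as a linear form in its second argument. -/
noncomputable def metricCLM (κ : ℝ) (p u : ℂ × ℝ) : ℂ × ℝ →L[ℝ] ℝ :=
  LinearMap.toContinuousLinearMap
    { toFun := metric κ p u
      map_add' := fun v w => metric_add_right κ p v w u
      map_smul' := fun c v => metric_smul_right κ c p u v }

variable {X : Type*} [TopologicalSpace X] [ChartedSpace (EuclideanSpace ℝ (Fin 2)) X]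
  {κ H : ℝ} {f N : X → ℂ × ℝ}

theorem differential_map {D : Set (ℂ × ℝ)} {Φ : ℂ × ℝ → ℂ × ℝ} {φ : X ≃ₘ^∞⟮𝓡 2, 𝓡 2⟯ X}
    (hf : ContMDiff (𝓡 2) 𝓘(ℝ, ℂ × ℝ) ∞ f) (hinv : IsInvariantVia f N D Φ φ) {p : X}
    (hΦ : DifferentiableAt ℝ Φ (f p)) (v : TangentSpace (𝓡 2) p) :
    differential f (φ p) (mfderiv (𝓡 2) (𝓡 2) φ p v) = fderiv ℝ Φ (f p) (differential f p v) := by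
  have h1 := mfderiv_comp p ((hf (φ p)).mdifferentiableAt (by simp))
    ((φ.contMDiff p).mdifferentiableAt (by simp))
  have h2 := mfderiv_comp p hΦ.mdifferentiableAt ((hf p).mdifferentiableAt (by simp))
  have h3 : f ∘ φ = Φ ∘ f := funext fun p => (hinv.map_eq p).symm
  rw [h3, h2, mfderiv_eq_fderiv] at h1
  exact (congrArg (fun L : E2 →L[ℝ] ℂ × ℝ => L v) h1).symm

/-- Φ preserves the volume form, the normal and the vertical component, so pulling back the form
only replaces the field and its hamiltonian by the given combination. -/
theorem pullback_verticalForm {D : Set (ℂ × ℝ)} {Φ : ℂ × ℝ → ℂ × ℝ} {φ : X ≃ₘ^∞⟮𝓡 2, 𝓡 2⟯ X}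
    (hf : IsOrientedImmersion κ f N) (hinv : IsInvariantVia f N D Φ φ)
    {S Sa Sb : ℂ × ℝ → ℂ × ℝ} {h ha hb : ℂ × ℝ → ℝ} {α β : ℝ}
    (hΦ : Intertwines κ Φ D S h α Sa ha β Sb hb) :
    pullback φ (verticalForm κ H f N S h) = fun p v =>
      α * verticalForm κ H f N Sa ha p v + β * verticalForm κ H f N Sb hb p v := by
  funext p v
  obtain ⟨m, hm, hS, hh⟩ := hΦ (f p) (hf.mem_space p) (hinv.mem_dom p)
  have h1 := differential_map hf.smooth hinv hm.differentiableAt v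
  simp only [pullback, verticalForm, noetherCLM_apply]
  rw [h1, ← hinv.map_eq, ← hinv.normal_eq, hS, hm.vol_map, hh, hm.fderiv_apply]
  simp only [vol_eq, Prod.fst_add, Prod.snd_add, Prod.smul_fst, Prod.smul_snd, Complex.add_re,
    Complex.add_im, Complex.real_smul, Complex.re_ofReal_mul, Complex.im_ofReal_mul, smul_eq_mul]
  ring

variable [SecondCountableTopology X] [IsManifold (𝓡 2) ∞ X]

/-- The orbit t ↦ Φ_t(f q) stays on the surface, at the points φ_t(q). The φ_t are chosen with no
regularity in t, but the uncountably many pairs (t, φ_t(q)) accumulate at one of them. There the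
orbit meets a small immersed piece at parameters tending to t₀, so its velocity, a nonzero multiple
of S, is tangent. -/
theorem metric_generator_eq_zero_of_invariant (hf : IsOrientedImmersion κ f N)
    {D : ℝ → Set (ℂ × ℝ)} {Φ : ℝ → ℂ × ℝ → ℂ × ℝ} {S Sb : ℂ × ℝ → ℂ × ℝ} {h hb : ℂ × ℝ → ℝ}
    (hinv : ∀ t, IsParam κ t → IsInvariantUnder f N (D t) (Φ t))
    (hΦ : ∀ t, IsParam κ t → Intertwines κ (Φ t) (D t) S h 1 S h 0 Sb hb)
    (hd : ∀ t, IsParam κ t → ∀ x ∈ D t, ∃ r : ℝ, r ≠ 0 ∧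
      HasDerivAt (fun s => Φ s x) (r • S (Φ t x)) t) (q : X) :
    metric κ (f q) (N q) (S (f q)) = 0 := by
  choose φ hφ using hinv
  have := uncountable_param κ
  -- The parameter is kept in the pair so that t and φ_t(q) converge together.
  obtain ⟨⟨t₀, ht₀⟩, hne⟩ := exists_neBot_comap_nhds
    fun t : {t : ℝ // IsParam κ t} => (t.1, φ t.1 t.2 q)
  set l := Filter.comap (fun t : {t : ℝ // IsParam κ t} => (t.1, φ t.1 t.2 q))
    (nhds (t₀, φ t₀ ht₀ q)) ⊓ Filter.principal {⟨t₀, ht₀⟩}ᶜ with hl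
  have hψ : Filter.Tendsto (fun t : {t : ℝ // IsParam κ t} => (t.1, φ t.1 t.2 q)) l
      (nhds (t₀, φ t₀ ht₀ q)) := Filter.tendsto_comap.mono_left inf_le_left
  rw [nhds_prod_eq, Filter.tendsto_prod_iff'] at hψ
  obtain ⟨h1, h2⟩ := hψ
  dsimp only at h1 h2
  set p := φ t₀ ht₀ q with hp
  obtain ⟨r, hr, hd⟩ := hd t₀ ht₀ (f q) ((hφ t₀ ht₀).mem_dom q)
  have hk : HasFDerivAt (inChart f p) (differential f p) (extChartAt (𝓡 2) p p) := by
    rw [differential_eq ((hf.smooth p).mdifferentiableAt (by simp))]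
    exact ((contDiffAt_inChart hf.smooth p (mem_extChartAt_target p)).differentiableAt
      (by simp)).hasFDerivAt
  have h3 := apply_velocity_eq_zero_of_frequently_mem hk (hf.injective p) hd
    ((continuousAt_extChartAt p).tendsto.comp h2) h1 (by
      have : ∀ᶠ a in l, a ≠ ⟨t₀, ht₀⟩ :=
        Filter.mem_inf_of_right (Filter.mem_principal_self _)
      filter_upwards [this] with a ha hat
      exact ha (Subtype.ext hat))
    (by rw [inChart, extChartAt_to_inv, (hφ t₀ ht₀).map_eq])
    (by
      filter_upwards [h2.eventually (extChartAt_source_mem_nhds (I := 𝓡 2) p)] with a ha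
      rw [inChart, Function.comp_apply, (extChartAt (𝓡 2) p).left_inv ha, (hφ a.1 a.2).map_eq])
    (metricCLM κ (f p) (N p)) (hf.normal p)
  have h4 : metric κ (f p) (N p) (S (f p)) = 0 := by
    rw [map_smul, smul_eq_zero, (hφ t₀ ht₀).map_eq] at h3
    exact h3.resolve_left hr
  -- Tangency is known only at φ_{t₀}(q). The isometry Φ_{t₀} preserves the metric, the normal and
  -- S, which carries it back to q.
  obtain ⟨m, hm, hS, -⟩ := hΦ t₀ ht₀ (f q) (hf.mem_space q) ((hφ t₀ ht₀).mem_dom q)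
  rw [hp, ← (hφ t₀ ht₀).map_eq, ← (hφ t₀ ht₀).normal_eq, hS, hm.metric_map] at h4
  simpa using h4

theorem hasDerivAt_mk_snd {g : ℝ → ℂ} {g' : ℂ} {t : ℝ} (hg : HasDerivAt g g' t) (z : ℝ) :
    HasDerivAt (fun s => (g s, z)) (g', (0 : ℝ)) t :=
  hg.prodMk (hasDerivAt_const t z)

/-- The parameter t is not the flow time: the velocity of the orbit is the generator divided by 1 +
(κ/4)t², since (1 - (κ/4)tw)² + (κ/4)(t + w)² = (1 + (κ/4)t²)(1 + (κ/4)w²). -/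
theorem hasDerivAt_trans1 {t : ℝ} (ht : IsParam κ t) {x : ℂ × ℝ} (hx : x ∈ dom1 κ t) :
    ∃ r : ℝ, r ≠ 0 ∧ HasDerivAt (fun s => trans1 κ s x) (r • gen1 κ (trans1 κ t x)) t := by
  have hx' : 1 - (κ / 4 : ℝ) * t * x.1 ≠ 0 := hx
  have hp := param_ne_zero ht
  have hp' := ofReal_param_ne_zero ht
  refine ⟨4 / (4 + κ * t ^ 2), div_ne_zero four_ne_zero hp, ?_⟩
  have ho : HasDerivAt (fun s : ℝ => (s : ℂ)) 1 t := Complex.ofRealCLM.hasDerivAt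
  have h := hasDerivAt_mk_snd ((ho.add_const x.1).div
    (((ho.const_mul ((κ / 4 : ℝ) : ℂ)).mul_const x.1).const_sub 1) hx') x.2
  convert! h using 1
  rw [gen1_eq]
  refine Prod.ext ?_ (by simp)
  simp only [trans1, Prod.smul_mk, Complex.real_smul]
  push_cast at hx' ⊢
  have hx'' : 4 - (κ : ℂ) * t * x.1 ≠ 0 := fun h0 => hx' (by linear_combination h0 / 4)
  field_simp
  ring

theorem hasDerivAt_trans2 {t : ℝ} (ht : IsParam κ t) {x : ℂ × ℝ} (hx : x ∈ dom2 κ t) :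
    ∃ r : ℝ, r ≠ 0 ∧ HasDerivAt (fun s => trans2 κ s x) (r • gen2 κ (trans2 κ t x)) t := by
  have hx' : 1 + Complex.I * (κ / 4 : ℝ) * t * x.1 ≠ 0 := hx
  have hp := param_ne_zero ht
  have hp' := ofReal_param_ne_zero ht
  refine ⟨4 / (4 + κ * t ^ 2), div_ne_zero four_ne_zero hp, ?_⟩
  have ho : HasDerivAt (fun s : ℝ => (s : ℂ)) 1 t := Complex.ofRealCLM.hasDerivAt
  have h := hasDerivAt_mk_snd (((ho.const_mul Complex.I).add_const x.1).div
    (((ho.const_mul (Complex.I * (κ / 4 : ℝ))).mul_const x.1).const_add 1) hx') x.2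
  convert! h using 1
  rw [gen2_eq]
  refine Prod.ext ?_ (by simp)
  simp only [trans2, Prod.smul_mk, Complex.real_smul]
  push_cast at hx' ⊢
  have hx'' : 4 + (κ : ℂ) * t * Complex.I * x.1 ≠ 0 := fun h0 => hx' (by linear_combination h0 / 4)
  have hi := Complex.I_sq
  generalize Complex.I = i at *
  field_simp
  linear_combination i * (κ ^ 2 * t ^ 2 * x.1 ^ 2 - 4 * κ * t ^ 2) * hi

end Invariance

/-! ### Noether invariants for arbitrary potential vectors -/

section Noether

variable {X : Type*} [TopologicalSpace X] [ChartedSpace (EuclideanSpace ℝ (Fin 2)) X]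
  {κ H : ℝ} {f N : X → ℂ × ℝ} {S F : ℂ × ℝ → ℂ × ℝ} {h : ℂ × ℝ → ℝ}

/-- The Noether forms of a field relative to two potential vectors differ by an exact form. -/
theorem exists_noetherForm_eq (hf : IsOrientedImmersion κ f N) (hS : IsMomentum κ S h)
    (hF : IsPotential κ S F) : ∃ η : (p : X) → TangentSpace (𝓡 2) p → ℝ, IsExact η ∧
      noetherForm κ H f N S F
        = fun p v => 1 * verticalForm κ H f N S h p v + (-2 * H) * η p v := by
  obtain ⟨G, hG, hGd⟩ := hS.exists_gradient hF
  refine ⟨fun p v => fderiv ℝ G (f p) (differential f p v),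
    ⟨fun p => G (f p), contMDiff_comp_of_space hf hG, fun p v => ?_⟩, ?_⟩
  · have h1 : DifferentiableAt ℝ G (f p) :=
      (hG.contDiffAt ((isOpen_space κ).mem_nhds (hf.mem_space p))).differentiableAt (by simp)
    have h2 := mfderiv_comp p h1.mdifferentiableAt ((hf.smooth p).mdifferentiableAt (by simp))
    rw [mfderiv_eq_fderiv] at h2
    exact (congrArg (fun L : EuclideanSpace ℝ (Fin 2) →L[ℝ] ℝ => L v) h2).symm
  · funext p v
    have h1 := hGd (f p) (hf.mem_space p) (differential f p v)
    change vol κ (f p) (N p) (S (f p)) (differential f p v)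
      - 2 * H * metric κ (f p) (F (f p)) (differential f p v) = _
    rw [h1, verticalForm, noetherCLM_apply]
    ring

theorem isExact_noetherForm (hf : IsOrientedImmersion κ f N) (hS : IsMomentum κ S h)
    (hF : IsPotential κ S F) (hv : IsExact (verticalForm κ H f N S h)) :
    IsExact (noetherForm κ H f N S F) := by
  obtain ⟨η, hη, he⟩ := exists_noetherForm_eq hf hS hF (H := H)
  rw [he]
  exact isExact_linear_comb hv hη _ _

/-- The exact difference between two choices of potential has zero integral on a cycle, so the
vertical potential computes every invariant. -/
theorem noetherInvariant_eq (hf : IsOrientedImmersion κ f N) (hS : IsMomentum κ S h)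
    (hF : IsPotential κ S F) {c : Simplex1 X →₀ ℤ} (hc : IsCycle c) :
    noetherInvariant κ H f N S F c = integral (verticalForm κ H f N S h) c := by
  obtain ⟨η, hη, he⟩ := exists_noetherForm_eq hf hS hF (H := H)
  rw [noetherInvariant, he, integral_linear_comb (isSimplexIntegrable_verticalForm hS H hf)
    (isSimplexIntegrable_of_isExact hη), integral_eq_zero_of_isExact hη hc]
  ring

variable [IsManifold (𝓡 2) ∞ X]

/-- If the field `S` is tangent to the surface, the Noether form of its brackets is exact. -/
theorem noetherVanishes_of_tangent {c : ℝ} {T U : ℂ × ℝ → ℂ × ℝ} {hS hT hU : ℂ × ℝ → ℝ}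
    (hf : IsCMC κ H f N) (hS' : IsMomentum κ S hS) (hT' : IsMomentum κ T hT)
    (hU' : IsMomentum κ U hU) (hc : c ≠ 0) (hb : IsBracket κ c S T U hS hT hU)
    (ht : ∀ p, metric κ (f p) (N p) (S (f p)) = 0) (hF : IsPotential κ U F) :
    NoetherVanishes κ H f N U F := by
  have h := isExact_noetherForm hf.1 hU' hF
    (isExact_verticalForm_of_tangent hf hS' hT' hc hb ht)
  exact ⟨h, fun c hc => integral_eq_zero_of_isExact h hc⟩

/-- The transformation law of the Noether invariant of a cycle homologous to its image. -/
theorem integral_verticalForm_of_homologous {D : Set (ℂ × ℝ)} {Φ : ℂ × ℝ → ℂ × ℝ}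
    {φ : X ≃ₘ^∞⟮𝓡 2, 𝓡 2⟯ X} (hf : IsCMC κ H f N) (hinv : IsInvariantVia f N D Φ φ)
    {Sa Sb : ℂ × ℝ → ℂ × ℝ} {ha hb : ℂ × ℝ → ℝ} {α β : ℝ}
    (hΦ : Intertwines κ Φ D S h α Sa ha β Sb hb) (hS : IsMomentum κ S h)
    (hSa : IsMomentum κ Sa ha) (hSb : IsMomentum κ Sb hb) {c : Simplex1 X →₀ ℤ}
    (hc : Homologous c (pushforward φ c)) :
    integral (verticalForm κ H f N S h) c = α * integral (verticalForm κ H f N Sa ha) c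
      + β * integral (verticalForm κ H f N Sb hb) c := by
  rw [← integral_eq_of_homologous (integral_verticalForm_boundary hS hf) hc,
    integral_pushforward, pullback_verticalForm hf.1 hinv hΦ,
    integral_linear_comb (isSimplexIntegrable_verticalForm hSa H hf.1)
      (isSimplexIntegrable_verticalForm hSb H hf.1)]

/-- Two Noether invariants vanish if they are transformed linearly by the isometry, without
fixed vectors. -/
theorem noetherInvariant_eq_zero_of_homologous {D : Set (ℂ × ℝ)} {Φ : ℂ × ℝ → ℂ × ℝ}
    {φ : X ≃ₘ^∞⟮𝓡 2, 𝓡 2⟯ X} (hf : IsCMC κ H f N) (hinv : IsInvariantVia f N D Φ φ)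
    {Sa Sb Fa Fb : ℂ × ℝ → ℂ × ℝ} {ha hb : ℂ × ℝ → ℝ} {α β α' β' : ℝ}
    (hΦa : Intertwines κ Φ D Sa ha α Sa ha β Sb hb)
    (hΦb : Intertwines κ Φ D Sb hb α' Sa ha β' Sb hb)
    (hdet : (α - 1) * (β' - 1) - β * α' ≠ 0)
    (hSa : IsMomentum κ Sa ha) (hSb : IsMomentum κ Sb hb)
    (hFa : IsPotential κ Sa Fa) (hFb : IsPotential κ Sb Fb) {c : Simplex1 X →₀ ℤ}
    (hc : IsCycle c) (hφ : Homologous c (pushforward φ c)) :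
    noetherInvariant κ H f N Sa Fa c = 0 ∧ noetherInvariant κ H f N Sb Fb c = 0 := by
  rw [noetherInvariant_eq hf.1 hSa hFa hc, noetherInvariant_eq hf.1 hSb hFb hc]
  have h1 := integral_verticalForm_of_homologous hf hinv hΦa hSa hSa hSb hφ
  have h2 := integral_verticalForm_of_homologous hf hinv hΦb hSb hSa hSb hφ
  generalize integral (verticalForm κ H f N Sa ha) c = x at *
  generalize integral (verticalForm κ H f N Sb hb) c = y at *
  -- Cramer's rule for the homogeneous system with matrix M - I, whose determinant is `hdet`.
  constructor
  · refine (mul_eq_zero.1 ?_).resolve_left hdet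
    linear_combination (1 - β') * h1 + β * h2
  · refine (mul_eq_zero.1 ?_).resolve_left hdet
    linear_combination α' * h1 + (1 - α) * h2

/-- The matrix of a translation has determinant one, so det(M - I) = 2 - tr M = κt²/(1 + (κ/4)t²),
nonzero for κ ≠ 0 and t ≠ 0. -/
theorem translation_det_ne_zero {t : ℝ} (hκ : κ ≠ 0) (ht : IsParam κ t) (h0 : t ≠ 0) :
    ((1 - κ / 4 * t ^ 2) / (1 + κ / 4 * t ^ 2) - 1)
        * ((1 - κ / 4 * t ^ 2) / (1 + κ / 4 * t ^ 2) - 1)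
      + κ * t / (1 + κ / 4 * t ^ 2) * (t / (1 + κ / 4 * t ^ 2)) ≠ 0 := by
  have hp : 1 + κ / 4 * t ^ 2 ≠ 0 := ne_of_gt ht
  have he : ((1 - κ / 4 * t ^ 2) / (1 + κ / 4 * t ^ 2) - 1)
        * ((1 - κ / 4 * t ^ 2) / (1 + κ / 4 * t ^ 2) - 1)
      + κ * t / (1 + κ / 4 * t ^ 2) * (t / (1 + κ / 4 * t ^ 2))
      = κ * t ^ 2 / (1 + κ / 4 * t ^ 2) := by
    generalize hd : 1 + κ / 4 * t ^ 2 = d at *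
    have hk : κ / 4 * t ^ 2 = d - 1 := by linarith
    have hk' : κ * t ^ 2 = 4 * (d - 1) := by linarith
    rw [hk]
    field_simp
    linear_combination (1 - d) * hk'
  rw [he]
  positivity

end Noether

/-! ### The main theorem -/

theorem mainTheorem4 (κ : ℝ) (hκ : κ ≠ 0)
    {X : Type*} [TopologicalSpace X] [T2Space X] [SecondCountableTopology X]
    [ChartedSpace (EuclideanSpace ℝ (Fin 2)) X] [IsManifold (𝓡 2) ∞ X]
    (H : ℝ) (f N : X → ℂ × ℝ) (hf : IsCMC κ H f N)
    (F₁ F₂ F_R : ℂ × ℝ → ℂ × ℝ) (hF₁ : IsPotential κ (gen1 κ) F₁)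
    (hF₂ : IsPotential κ (gen2 κ) F₂) (hF_R : IsPotential κ genR F_R) :
    -- (i) invariance under the whole family of translations
    ((∀ t : ℝ, IsParam κ t → IsInvariantUnder f N (dom1 κ t) (trans1 κ t)) →
      NoetherVanishes κ H f N (gen2 κ) F₂ ∧ NoetherVanishes κ H f N genR F_R) ∧
    ((∀ t : ℝ, IsParam κ t → IsInvariantUnder f N (dom2 κ t) (trans2 κ t)) →
      NoetherVanishes κ H f N (gen1 κ) F₁ ∧ NoetherVanishes κ H f N genR F_R) ∧
    -- (i) invariance under one translation, for a cycle homologous to its image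
    (∀ t : ℝ, IsParam κ t → t ≠ 0 → ∀ φ : X ≃ₘ^∞⟮𝓡 2, 𝓡 2⟯ X,
      IsInvariantVia f N (dom1 κ t) (trans1 κ t) φ →
      ∀ c : Simplex1 X →₀ ℤ, IsCycle c → Homologous c (pushforward φ c) →
        noetherInvariant κ H f N (gen2 κ) F₂ c = 0 ∧
        noetherInvariant κ H f N genR F_R c = 0) ∧
    (∀ t : ℝ, IsParam κ t → t ≠ 0 → ∀ φ : X ≃ₘ^∞⟮𝓡 2, 𝓡 2⟯ X,
      IsInvariantVia f N (dom2 κ t) (trans2 κ t) φ →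
      ∀ c : Simplex1 X →₀ ℤ, IsCycle c → Homologous c (pushforward φ c) →
        noetherInvariant κ H f N (gen1 κ) F₁ c = 0 ∧
        noetherInvariant κ H f N genR F_R c = 0) ∧
    -- (ii) invariance under one rotation, for a cycle homologous to its image
    (∀ t : ℝ, (∀ k : ℤ, t ≠ 2 * Real.pi * k) → ∀ φ : X ≃ₘ^∞⟮𝓡 2, 𝓡 2⟯ X,
      IsInvariantVia f N univ (rot t) φ →
      ∀ c : Simplex1 X →₀ ℤ, IsCycle c → Homologous c (pushforward φ c) →
        noetherInvariant κ H f N (gen1 κ) F₁ c = 0 ∧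
        noetherInvariant κ H f N (gen2 κ) F₂ c = 0) := by
  have h1 := isMomentum_gen1 κ
  have h2 := isMomentum_gen2 κ
  have hR := isMomentum_genR hκ
  refine ⟨fun hinv => ?_, fun hinv => ?_, fun t ht h0 φ hφ c hc hcφ => ?_,
    fun t ht h0 φ hφ c hc hcφ => ?_, fun t ht φ hφ c hc hcφ => ?_⟩
  -- With S₁ tangent, the exact forms are those of the brackets [S₁, S_R] = S₂ and [S₁, S₂] = -κ
  -- S_R.
  · have ht := metric_generator_eq_zero_of_invariant hf.1 hinv
      (fun _ ht => intertwines_trans1_gen1 ht) (fun _ ht _ hx => hasDerivAt_trans1 ht hx)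
    exact ⟨noetherVanishes_of_tangent hf h1 hR h2 one_ne_zero (bracket_1R hκ) ht hF₂,
      noetherVanishes_of_tangent hf h1 h2 hR (neg_ne_zero.2 hκ) (bracket_12 hκ) ht hF_R⟩
  · have ht := metric_generator_eq_zero_of_invariant hf.1 hinv
      (fun _ ht => intertwines_trans2_gen2 ht) (fun _ ht _ hx => hasDerivAt_trans2 ht hx)
    exact ⟨noetherVanishes_of_tangent hf h2 hR h1 (neg_ne_zero.2 one_ne_zero) (bracket_2R hκ)
        ht hF₁,
      noetherVanishes_of_tangent hf h2 h1 hR (neg_ne_zero.2 (neg_ne_zero.2 hκ))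
        (bracket_12 hκ).swap ht hF_R⟩
  · refine noetherInvariant_eq_zero_of_homologous hf hφ (intertwines_trans1_gen2 hκ ht)
      (intertwines_trans1_genR hκ ht) ?_ h2 hR hF₂ hF_R hc hcφ
    convert! translation_det_ne_zero hκ ht h0 using 1
    ring
  · refine noetherInvariant_eq_zero_of_homologous hf hφ (intertwines_trans2_gen1 hκ ht)
      (intertwines_trans2_genR hκ ht) ?_ h1 hR hF₁ hF_R hc hcφ
    convert! translation_det_ne_zero hκ ht h0 using 1
    ring
  · refine noetherInvariant_eq_zero_of_homologous hf hφ (intertwines_rot_gen1 κ t)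
      (intertwines_rot_gen2 κ t) (fun h => ?_) h1 h2 hF₁ hF₂ hc hcφ
    -- Here det(M - I) = (cos t - 1)² + sin² t = 2 - 2 cos t.
    have hcos : Real.cos t = 1 := by linarith [Real.sin_sq_add_cos_sq t]
    obtain ⟨k, hk⟩ := (Real.cos_eq_one_iff t).1 hcos
    exact ht k (by rw [← hk]; ring)
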